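/- Let $f_1,\dots,f_n:\mathbb R^d\to\mathbb R$ be differentiable with $\|\nabla f_i(x)-\nabla f_i(y)\|\le L\|x-y\|$ ($L>0$) and $\|\nabla f_i(x)\|^2\le\sigma^2$ for all $i,x,y$ (Euclidean norm), and let $\psi:\mathbb R^d\to\mathbb R$ be convex. Put $f=\frac1n\sum_{i=1}^n f_i$, $F=f+\psi$, and let $x^*$ be a minimizer of $F$. For $\eta>0$ let $\mathrm{Prox}_{\eta\psi}(x)=\arg\min_y\{\psi(y)+\frac1{2\eta}\|y-x\|^2\}$ and $g_\eta(x)=\frac1\eta\big(x-\mathrm{Prox}_{\eta\psi}(x-\eta\nabla f(x))\big)$. For $\mu>0$ and $u\in\mathbb R^d$ the Gaussian smoothing gradient estimate (GauSGE) of $f_i$ at $x$ is $\hat\nabla_u f_i(x)=\frac{f_i(x+\mu u)-f_i(x)}{\mu}\,u$. ZO-ProxSAGA with GauSGE, mini-batch size $1\le b\le n$ and a given starting point $x_0\in\mathbb R^d$, is the following random iteration. Start with $z_i^0=x_0$, $w_i^0\sim\mathcal N(0,I)$ for $i=1,\dots,n$, and $\hat\phi_0=\frac1n\sum_i\hat\nabla_{w_i^0}f_i(z_i^0)$.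 In iteration $t=0,1,2,\dots$ draw $b$ indices $i_1,\dots,i_b$ uniformly from $\{1,\dots,n\}$ with replacement, let $\mathcal I_t$ be the set of indices that occur, and draw directions $u_i^t\sim\mathcal N(0,I)$, $i=1,\dots,n$; all draws, over all iterations and including those of the initialization, are mutually independent. Set $$\hat v_t=\frac1b\sum_{k=1}^b\big(\hat\nabla_{u^t_{i_k}}f_{i_k}(x_t)-\hat\nabla_{w^t_{i_k}}f_{i_k}(z^t_{i_k})\big)+\hat\phi_t,\qquad x_{t+1}=\mathrm{Prox}_{\eta\psi}(x_t-\eta\hat v_t),$$ $(z_i^{t+1},w_i^{t+1})=(x_t,u_i^t)$ for $i\in\mathcal I_t$ and $(z_i^{t+1},w_i^{t+1})=(z_i^t,w_i^t)$ otherwise, and $\hat\phi_{t+1}=\hat\phi_t-\frac1n\sum_{i\in\mathcal I_t}\big(\hat\nabla_{w_i^t}f_i(z_i^t)-\hat\nabla_{w_i^{t+1}}f_i(z_i^{t+1})\big)$. (1) Let $0<\rho<\frac12$, $\eta=\rho/L$, $\gamma=\frac\eta2-L\eta^2$, $T\ge1$, and suppose $\frac{96\rho^2n^2}{b^3}+\rho\le1$.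 Then all the expectations below are finite and $$\frac1T\sum_{t=1}^T\mathbb E\|g_\eta(x_t)\|^2\le\frac{F(x_0)-F(x^*)}{T\gamma}+\frac{(2+\frac{12}b)(2d+9)\sigma^2\eta}{\gamma}+\frac{(1+\frac6b)(d+6)^3L^2\mu^2\eta}{\gamma}.$$ (2) There is an absolute constant $C_2$ and, for all $L,K>0$, a constant $C_1$ depending only on $L$ and $K$ such that, whenever $n,T\ge1$, $b$ is $n^{2/3}$ rounded down or rounded up to an integer, $\rho=\frac1{12}$ (so $\eta=\frac1{12L}$) and $0<\mu\le\frac{K}{d\sqrt T}$, the expectations below are finite and $$\frac1T\sum_{t=1}^T\mathbb E\|g_\eta(x_t)\|^2\le\frac{144L\,(F(x_0)-F(x^*))}{5T}+C_1\frac dT+C_2\,d\sigma^2 .$$ -/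

import Mathlib

open MeasureTheory ProbabilityTheory

noncomputable section

namespace ZOProxSAGA

/-- The space `ℝ^d` with its Euclidean norm. -/
abbrev E (d : ℕ) : Type := EuclideanSpace ℝ (Fin d)

/-- The smooth part `f = (1/n) ∑ f_i`. -/
def avgLoss {d n : ℕ} (f : Fin n → E d → ℝ) (x : E d) : ℝ :=
  (1 / (n : ℝ)) * ∑ i, f i x

/-- The objective `F = f + ψ`. -/
def objective {d n : ℕ} (f : Fin n → E d → ℝ) (ψ : E d → ℝ) (x : E d) : ℝ :=
  avgLoss f x + ψ x

/-- The proximal operator `Prox_{ηψ}(x) = argmin_y { ψ(y) + ‖y - x‖² / (2η) }`. -/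
def prox {d : ℕ} (η : ℝ) (ψ : E d → ℝ) (x : E d) : E d :=
  Classical.epsilon fun y : E d =>
    IsMinOn (fun y' : E d => ψ y' + 1 / (2 * η) * ‖y' - x‖ ^ 2) Set.univ y

/-- The gradient mapping `g_η(x) = (x - Prox_{ηψ}(x - η ∇f(x))) / η`. -/
def gradMap {d n : ℕ} (η : ℝ) (f : Fin n → E d → ℝ) (ψ : E d → ℝ) (x : E d) : E d :=
  (1 / η) • (x - prox η ψ (x - η • gradient (avgLoss f) x))

/-- The Gaussian smoothing gradient estimate of `h` at `x` in the direction `u`: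
`((h(x + μ u) - h(x)) / μ) u`. -/
def gauSGE {d : ℕ} (μ : ℝ) (h : E d → ℝ) (x u : E d) : E d :=
  ((h (x + μ • u) - h x) / μ) • u

/-- The variables kept by the algorithm. -/
structure State (d n : ℕ) where
  /-- the iterate `x_t` -/
  x : E d
  /-- the reference points `z_i^t` -/
  z : Fin n → E d
  /-- the random direction with which the gradient of `f_i` at `z_i^t` was estimated -/
  w : Fin n → E d
  /-- the running average `φ_t` of the estimated gradients at the reference points -/
  φ : E d

/-- Initialization: `z_i^0 = x₀`, with `φ_0` the average of the estimates at `x₀`. -/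
def State.init {d n : ℕ} (f : Fin n → E d → ℝ) (μ : ℝ) (x₀ : E d) (u : Fin n → E d) :
    State d n where
  x := x₀
  z := fun _ => x₀
  w := u
  φ := (1 / (n : ℝ)) • ∑ i, gauSGE μ (f i) x₀ (u i)

/-- The mixture stochastic gradient `v_t` for the mini-batch `I` and the fresh directions `u`. -/
def State.v {d n b : ℕ} (f : Fin n → E d → ℝ) (μ : ℝ) (I : Fin b → Fin n) (u : Fin n → E d)
    (s : State d n) : E d :=
  ((1 / (b : ℝ)) • ∑ k, (gauSGE μ (f (I k)) s.x (u (I k)) -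
    gauSGE μ (f (I k)) (s.z (I k)) (s.w (I k)))) + s.φ

/-- One iteration. The mini-batch is drawn with replacement, so that `I` may have repetitions;
each index that occurs in it is updated once. -/
def State.step {d n b : ℕ} (f : Fin n → E d → ℝ) (ψ : E d → ℝ) (μ η : ℝ)
    (I : Fin b → Fin n) (u : Fin n → E d) (s : State d n) : State d n where
  x := prox η ψ (s.x - η • s.v f μ I u)
  z := fun i => if i ∈ Finset.univ.image I then s.x else s.z i
  w := fun i => if i ∈ Finset.univ.image I then u i else s.w i
  φ := s.φ - (1 / (n : ℝ)) • ∑ i ∈ Finset.univ.image I,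
    (gauSGE μ (f i) (s.z i) (s.w i) - gauSGE μ (f i) s.x (u i))

/-- The run of ZO-ProxSAGA from `x₀` with mini-batches `I t`. The directions `U 0` are used for
the initialization and the directions `U (t + 1)` in iteration `t`. -/
def run {d n b : ℕ} (f : Fin n → E d → ℝ) (ψ : E d → ℝ) (μ η : ℝ) (x₀ : E d)
    (I : ℕ → Fin b → Fin n) (U : ℕ → Fin n → E d) : ℕ → State d n
  | 0 => State.init f μ x₀ (U 0)
  | t + 1 => (run f ψ μ η x₀ I U t).step f ψ μ η (I t) (U (t + 1))

/-- The standing assumptions on the problem: each `f_i` has an `L`-Lipschitz gradient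
bounded by `σ`, and `ψ` is convex. -/
structure Assumptions {d n : ℕ} (f : Fin n → E d → ℝ) (ψ : E d → ℝ) (L σ : ℝ) : Prop where
  L_pos : 0 < L
  differentiable : ∀ i, Differentiable ℝ (f i)
  lipschitz : ∀ i x y, ‖gradient (f i) x - gradient (f i) y‖ ≤ L * ‖x - y‖
  bounded : ∀ i x, ‖gradient (f i) x‖ ^ 2 ≤ σ ^ 2
  convex : ConvexOn ℝ Set.univ ψ

/-- The randomness of the algorithm: all mini-batch indices are uniform on the `n` indices, all
directions are standard Gaussian, and all of these random variables are mutually independent. -/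
structure Sampling {d n b : ℕ} {Ω : Type*} [MeasurableSpace Ω] (P : Measure Ω)
    (I : ℕ → Fin b → Ω → Fin n) (U : ℕ → Fin n → Ω → E d) : Prop where
  measurable_index : ∀ t k, Measurable (I t k)
  measurable_direction : ∀ t i, Measurable (U t i)
  law_index : ∀ t k, P.map (I t k) = uniformOn Set.univ
  law_direction : ∀ t i, P.map (U t i) = stdGaussian (E d)
  indep_index : iIndepFun (fun q : ℕ × Fin b => I q.1 q.2) P
  indep_direction : iIndepFun (fun q : ℕ × Fin n => U q.1 q.2) P
  indep : IndepFun (fun ω (q : ℕ × Fin b) => I q.1 q.2 ω)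
    (fun ω (q : ℕ × Fin n) => U q.1 q.2 ω) P

/-- The random iterate `x_t`. -/
def iterate {d n b : ℕ} {Ω : Type*} (f : Fin n → E d → ℝ) (ψ : E d → ℝ) (μ η : ℝ) (x₀ : E d)
    (I : ℕ → Fin b → Ω → Fin n) (U : ℕ → Fin n → Ω → E d) (t : ℕ) (ω : Ω) : E d :=
  (run f ψ μ η x₀ (fun t k => I t k ω) (fun t i => U t i ω) t).x

end ZOProxSAGA

end

noncomputable section

namespace ZOProxSAGA

open scoped RealInnerProductSpace

/-! ### Moments of the standard Gaussian on `E d`. -/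

section GaussianMoments

/-! The proof is a Lyapunov argument for SAGA in which the gradient-estimation error is carried as
additive noise.

Compare the actual proximal step with the exact one. Two three-point inequalities, the quadratic
upper bound for `f` and Young's inequality show that `F` decreases by `η/2 ‖g_η(x)‖²` plus a
multiple of the squared step length, up to `η/2 ‖∇f(x) - v‖²` (`objective_prox_step_le`). Since `φ`
is the average of the stored estimates, averaging `v` over the batch leaves the mean of the fresh
estimates. Hence the squared error of `v` is at most the fresh error plus a variance of order `1/b`,
which involves the fresh error, the error of the stored estimates and `L²` times the mean of `‖x -
z_i‖²`.

The last quantity is added to `F - F*` with weight `c`. A reference point survives a batch with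
probability at most `1 - b/(2n)`, so this term contracts. The contraction pays for the variance, and
the step-length surplus pays for the drift of `x`, provided `30 (ηL)² n²/b³ + ηL ≤ 1`
(`indexAvg_lyapunov_step_le`).

What remains is noise. Gaussian moments bound a fresh error by `gauSGEErr`, uniformly in the point.
The expected stored error obeys the same bound: its batch average is a convex combination of old
stored and fresh errors (`indexAvg_tableErr_step`), so the joint law of stored points and directions
is never needed. Expectations are Lebesgue integrals of nonnegative functions, and integrability
comes out of the telescoped bound. Both claims follow from `sum_integral_norm_gradMap_sq_le`. -/

lemma hasDerivAt_mul_gaussian_mgf {p : ℝ → ℝ} {p' v t : ℝ} (hp : HasDerivAt p p' t) :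
    HasDerivAt (fun t => p t * Real.exp (v * t ^ 2 / 2))
      ((p' + v * t * p t) * Real.exp (v * t ^ 2 / 2)) t := by
  have h : HasDerivAt (fun t : ℝ => v * t ^ 2 / 2) (v * t) t := by
    exact (((hasDerivAt_pow 2 t).const_mul v).div_const 2).congr_deriv (by norm_num; ring)
  exact (hp.fun_mul h.exp).congr_deriv (by ring)

/-- The moments are derivatives at zero of the moment generating function `exp (v t² / 2)`; each
differentiation replaces a polynomial prefactor `p` by `p' + v t p`. -/
lemma integral_pow_gaussianReal (v : NNReal) :
    ∫ x, x ^ 2 ∂(gaussianReal 0 v) = v ∧ ∫ x, x ^ 4 ∂(gaussianReal 0 v) = 3 * v ^ 2 ∧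
      ∫ x, x ^ 6 ∂(gaussianReal 0 v) = 15 * v ^ 3 := by
  have key (k : ℕ) : ∫ x, x ^ k ∂(gaussianReal 0 v) =
      iteratedDeriv k (fun t : ℝ => Real.exp (v * t ^ 2 / 2)) 0 := by
    have h := iteratedDeriv_mgf_zero (X := id) (μ := gaussianReal 0 v)
      (by simp [integrableExpSet_id_gaussianReal]) k
    rw [mgf_id_gaussianReal] at h
    simpa using h.symm
  have d1 : deriv (fun t : ℝ => Real.exp (v * t ^ 2 / 2)) =
      fun t => (v * t) * Real.exp (v * t ^ 2 / 2) := by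
    ext t
    have := hasDerivAt_mul_gaussian_mgf (v := v) (hasDerivAt_const t (1 : ℝ))
    simpa using this.deriv
  have d2 : deriv (fun t : ℝ => (v * t) * Real.exp (v * t ^ 2 / 2)) =
      fun t => (v + v ^ 2 * t ^ 2) * Real.exp (v * t ^ 2 / 2) := by
    ext t
    rw [(hasDerivAt_mul_gaussian_mgf (v := v) ((hasDerivAt_id' t).const_mul (v : ℝ))).deriv]
    ring
  have d3 : deriv (fun t : ℝ => (v + v ^ 2 * t ^ 2) * Real.exp (v * t ^ 2 / 2)) =
      fun t => (3 * v ^ 2 * t + v ^ 3 * t ^ 3) * Real.exp (v * t ^ 2 / 2) := by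
    ext t
    rw [(hasDerivAt_mul_gaussian_mgf (v := v)
      (((hasDerivAt_pow 2 t).const_mul ((v : ℝ) ^ 2)).const_add (v : ℝ))).deriv]
    norm_num; ring
  have d4 : deriv (fun t : ℝ => (3 * v ^ 2 * t + v ^ 3 * t ^ 3) * Real.exp (v * t ^ 2 / 2)) =
      fun t => (3 * v ^ 2 + 6 * v ^ 3 * t ^ 2 + v ^ 4 * t ^ 4) * Real.exp (v * t ^ 2 / 2) := by
    ext t
    rw [(hasDerivAt_mul_gaussian_mgf (v := v) (((hasDerivAt_id' t).const_mul
      (3 * (v : ℝ) ^ 2)).fun_add ((hasDerivAt_pow 3 t).const_mul ((v : ℝ) ^ 3)))).deriv]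
    norm_num; ring
  have d5 : deriv (fun t : ℝ =>
      (3 * v ^ 2 + 6 * v ^ 3 * t ^ 2 + v ^ 4 * t ^ 4) * Real.exp (v * t ^ 2 / 2)) =
      fun t => (15 * v ^ 3 * t + 10 * v ^ 4 * t ^ 3 + v ^ 5 * t ^ 5) *
        Real.exp (v * t ^ 2 / 2) := by
    ext t
    rw [(hasDerivAt_mul_gaussian_mgf (v := v) ((((hasDerivAt_pow 2 t).const_mul
      (6 * (v : ℝ) ^ 3)).const_add (3 * (v : ℝ) ^ 2)).fun_add
        ((hasDerivAt_pow 4 t).const_mul ((v : ℝ) ^ 4)))).deriv]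
    norm_num; ring
  have d6 : deriv (fun t : ℝ => (15 * v ^ 3 * t + 10 * v ^ 4 * t ^ 3 + v ^ 5 * t ^ 5) *
        Real.exp (v * t ^ 2 / 2)) 0 = 15 * (v : ℝ) ^ 3 := by
    rw [(hasDerivAt_mul_gaussian_mgf (v := v) ((((hasDerivAt_id' 0).const_mul
      (15 * (v : ℝ) ^ 3)).fun_add ((hasDerivAt_pow 3 (0 : ℝ)).const_mul (10 * (v : ℝ) ^ 4))).fun_add
        ((hasDerivAt_pow 5 (0 : ℝ)).const_mul ((v : ℝ) ^ 5)))).deriv]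
    norm_num
  refine ⟨?_, ?_, ?_⟩
  · rw [key, iteratedDeriv_succ', iteratedDeriv_one, d1, d2]
    simp
  · rw [key, iteratedDeriv_succ', iteratedDeriv_succ', iteratedDeriv_succ', iteratedDeriv_one,
      d1, d2, d3, d4]
    simp
  · rw [key, iteratedDeriv_succ', iteratedDeriv_succ', iteratedDeriv_succ', iteratedDeriv_succ',
      iteratedDeriv_succ', iteratedDeriv_one, d1, d2, d3, d4, d5, d6]

variable {d : ℕ}

lemma map_inner_stdGaussian (a : E d) :
    (stdGaussian (E d)).map (fun u => ⟪a, u⟫) = gaussianReal 0 (‖a‖₊ ^ 2) := by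
  have h := IsGaussian.map_eq_gaussianReal (μ := stdGaussian (E d)) (innerSL ℝ a)
  rw [integral_strongDual_stdGaussian, variance_dual_stdGaussian] at h
  have e : (‖innerSL ℝ a‖ ^ 2).toNNReal = ‖a‖₊ ^ 2 := by
    ext; simp
  rw [e] at h
  exact h

lemma integrable_norm_pow_stdGaussian (k : ℕ) :
    Integrable (fun u : E d => ‖u‖ ^ k) (stdGaussian (E d)) := by
  have := (IsGaussian.memLp_id (stdGaussian (E d)) k (by simp)).integrable_norm_pow'
  simpa using this

lemma integral_inner_pow_stdGaussian (a : E d) (k : ℕ) :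
    ∫ u, ⟪a, u⟫ ^ k ∂(stdGaussian (E d)) = ∫ x, x ^ k ∂(gaussianReal 0 (‖a‖₊ ^ 2)) := by
  rw [← map_inner_stdGaussian, integral_map (by fun_prop) (by fun_prop)]

lemma integrable_inner_pow_stdGaussian (a : E d) (k : ℕ) :
    Integrable (fun u => ⟪a, u⟫ ^ k) (stdGaussian (E d)) := by
  refine ((integrable_norm_pow_stdGaussian (d := d) k).const_mul (‖a‖ ^ k)).mono'
    (by fun_prop) (.of_forall fun u => ?_)
  rw [norm_pow, ← mul_pow]
  gcongr
  exact norm_inner_le_norm a u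

lemma integral_inner_sq_stdGaussian (a : E d) :
    ∫ u, ⟪a, u⟫ ^ 2 ∂(stdGaussian (E d)) = ‖a‖ ^ 2 := by
  rw [integral_inner_pow_stdGaussian, (integral_pow_gaussianReal _).1]; simp

lemma integral_inner_pow_four_stdGaussian (a : E d) :
    ∫ u, ⟪a, u⟫ ^ 4 ∂(stdGaussian (E d)) = 3 * ⟪a, a⟫ ^ 2 := by
  rw [integral_inner_pow_stdGaussian, (integral_pow_gaussianReal _).2.1]; simp

lemma integral_inner_pow_six_stdGaussian (a : E d) :
    ∫ u, ⟪a, u⟫ ^ 6 ∂(stdGaussian (E d)) = 15 * ⟪a, a⟫ ^ 3 := by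
  rw [integral_inner_pow_stdGaussian, (integral_pow_gaussianReal _).2.2]; simp

/-- Polarization writes the product as a combination of fourth powers of single linear forms, whose
moments are one-dimensional. -/
lemma integral_inner_sq_mul_inner_sq_stdGaussian (a b : E d) :
    ∫ u, ⟪a, u⟫ ^ 2 * ⟪b, u⟫ ^ 2 ∂(stdGaussian (E d)) =
      ⟪a, a⟫ * ⟪b, b⟫ + 2 * ⟪a, b⟫ ^ 2 := by
  have e : ∀ u : E d, ⟪a, u⟫ ^ 2 * ⟪b, u⟫ ^ 2 = (1 / 12) * (⟪a + b, u⟫ ^ 4 + ⟪a - b, u⟫ ^ 4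
      - 2 * ⟪a, u⟫ ^ 4 - 2 * ⟪b, u⟫ ^ 4) := by
    intro u
    simp only [inner_add_left, inner_sub_left]
    ring
  have i4 (a : E d) := integrable_inner_pow_stdGaussian a 4
  simp_rw [e]
  rw [integral_const_mul, integral_sub (by fun_prop) (by fun_prop),
    integral_sub (by fun_prop) (by fun_prop), integral_add (by fun_prop) (by fun_prop),
    integral_const_mul, integral_const_mul]
  simp only [integral_inner_pow_four_stdGaussian]
  simp only [inner_add_left, inner_sub_left, inner_add_right,
    inner_sub_right, real_inner_comm a b]
  ring

lemma integral_inner_sq_mul_inner_sq_mul_inner_sq_stdGaussian (a b c : E d) :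
    ∫ u, ⟪a, u⟫ ^ 2 * ⟪b, u⟫ ^ 2 * ⟪c, u⟫ ^ 2 ∂(stdGaussian (E d)) =
      ⟪a, a⟫ * ⟪b, b⟫ * ⟪c, c⟫ + 2 * (⟪a, a⟫ * ⟪b, c⟫ ^ 2 + ⟪b, b⟫ * ⟪a, c⟫ ^ 2 +
        ⟪c, c⟫ * ⟪a, b⟫ ^ 2) + 8 * (⟪a, b⟫ * ⟪b, c⟫ * ⟪a, c⟫) := by
  have e : ∀ u : E d, ⟪a, u⟫ ^ 2 * ⟪b, u⟫ ^ 2 * ⟪c, u⟫ ^ 2 = (1 / 360) * (⟪a + b + c, u⟫ ^ 6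
      + ⟪a + b - c, u⟫ ^ 6 + ⟪a - b + c, u⟫ ^ 6 + ⟪a - b - c, u⟫ ^ 6
      - 2 * ⟪a + b, u⟫ ^ 6 - 2 * ⟪a - b, u⟫ ^ 6 - 2 * ⟪a + c, u⟫ ^ 6 - 2 * ⟪a - c, u⟫ ^ 6
      - 2 * ⟪b + c, u⟫ ^ 6 - 2 * ⟪b - c, u⟫ ^ 6
      + 4 * ⟪a, u⟫ ^ 6 + 4 * ⟪b, u⟫ ^ 6 + 4 * ⟪c, u⟫ ^ 6) := by
    intro u
    simp only [inner_add_left, inner_sub_left]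
    ring
  have i6 (a : E d) := integrable_inner_pow_stdGaussian a 6
  simp_rw [e]
  rw [integral_const_mul]
  repeat rw [integral_add (by fun_prop) (by fun_prop)]
  repeat rw [integral_sub (by fun_prop) (by fun_prop)]
  repeat rw [integral_add (by fun_prop) (by fun_prop)]
  simp only [integral_const_mul, integral_inner_pow_six_stdGaussian]
  simp only [inner_add_left, inner_sub_left, inner_add_right,
    inner_sub_right, real_inner_comm a b, real_inner_comm b c, real_inner_comm a c]
  ring

lemma integrable_inner_sq_mul_norm_sq_stdGaussian (a : E d) :
    Integrable (fun u => ⟪a, u⟫ ^ 2 * ‖u‖ ^ 2) (stdGaussian (E d)) := by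
  refine ((integrable_norm_pow_stdGaussian (d := d) 4).const_mul (‖a‖ ^ 2)).mono'
    (by fun_prop) (.of_forall fun u => ?_)
  have := abs_real_inner_le_norm a u
  rw [norm_mul, norm_pow, norm_pow, norm_norm, Real.norm_eq_abs,
    show ‖a‖ ^ 2 * ‖u‖ ^ 4 = (‖a‖ * ‖u‖) ^ 2 * ‖u‖ ^ 2 by ring]
  gcongr

lemma integral_inner_sq_mul_norm_sq_stdGaussian (a : E d) :
    ∫ u, ⟪a, u⟫ ^ 2 * ‖u‖ ^ 2 ∂(stdGaussian (E d)) = (d + 2) * ‖a‖ ^ 2 := by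
  let B := EuclideanSpace.basisFun (Fin d) ℝ
  have hn (u : E d) : ‖u‖ ^ 2 = ∑ i, ⟪B i, u⟫ ^ 2 := (B.sum_sq_inner_right u).symm
  have hi (i : Fin d) : Integrable (fun u => ⟪a, u⟫ ^ 2 * ⟪B i, u⟫ ^ 2) (stdGaussian (E d)) := by
    refine (integrable_inner_sq_mul_norm_sq_stdGaussian a).mono' (by fun_prop)
      (.of_forall fun u => ?_)
    rw [Real.norm_of_nonneg (by positivity)]
    refine mul_le_mul_of_nonneg_left ?_ (sq_nonneg _)
    rw [hn]
    exact Finset.single_le_sum (f := fun i => ⟪B i, u⟫ ^ 2) (fun _ _ => sq_nonneg _)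
      (Finset.mem_univ i)
  simp_rw [hn, Finset.mul_sum]
  rw [integral_finsetSum _ (fun i _ => hi i)]
  simp_rw [integral_inner_sq_mul_inner_sq_stdGaussian, real_inner_self_eq_norm_sq]
  rw [Finset.sum_add_distrib, ← Finset.mul_sum]
  have hn' : ‖a‖ ^ 2 = ∑ i, ⟪a, B i⟫ ^ 2 := (B.sum_sq_inner_left a).symm
  rw [← Finset.mul_sum, ← Finset.mul_sum, ← hn', ← hn a]
  simp
  ring

/-- Expand `‖u‖²` in an orthonormal basis; in the triple sum the inner products of basis vectors are
Kronecker deltas. -/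
lemma integral_norm_pow_six_stdGaussian :
    ∫ u : E d, ‖u‖ ^ 6 ∂(stdGaussian (E d)) = (d : ℝ) ^ 3 + 6 * (d : ℝ) ^ 2 + 8 * d := by
  let B := EuclideanSpace.basisFun (Fin d) ℝ
  have hn (u : E d) : ‖u‖ ^ 2 = ∑ i, ⟪B i, u⟫ ^ 2 := (B.sum_sq_inner_right u).symm
  have hs (i : Fin d) (u : E d) : ⟪B i, u⟫ ^ 2 ≤ ‖u‖ ^ 2 := by
    rw [hn]
    exact Finset.single_le_sum (f := fun i => ⟪B i, u⟫ ^ 2) (fun _ _ => sq_nonneg _)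
      (Finset.mem_univ i)
  have hi (i j k : Fin d) : Integrable (fun u => ⟪B i, u⟫ ^ 2 * ⟪B j, u⟫ ^ 2 * ⟪B k, u⟫ ^ 2)
      (stdGaussian (E d)) := by
    refine (integrable_norm_pow_stdGaussian (d := d) 6).mono' (by fun_prop)
      (.of_forall fun u => ?_)
    rw [Real.norm_of_nonneg (by positivity), show ‖u‖ ^ 6 = ‖u‖ ^ 2 * ‖u‖ ^ 2 * ‖u‖ ^ 2 by ring]
    exact mul_le_mul (mul_le_mul (hs i u) (hs j u) (by positivity) (by positivity)) (hs k u)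
      (by positivity) (by positivity)
  have e (u : E d) : ‖u‖ ^ 6 = ∑ i, ∑ j, ∑ k, ⟪B i, u⟫ ^ 2 * ⟪B j, u⟫ ^ 2 * ⟪B k, u⟫ ^ 2 := by
    rw [show ‖u‖ ^ 6 = ‖u‖ ^ 2 * ‖u‖ ^ 2 * ‖u‖ ^ 2 by ring, hn, Finset.sum_mul_sum,
      Finset.sum_mul]
    simp_rw [Finset.sum_mul_sum]
  simp_rw [e]
  rw [integral_finsetSum _ (fun i _ => integrable_finsetSum _ fun j _ =>
    integrable_finsetSum _ fun k _ => hi i j k)]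
  simp_rw [fun i => integral_finsetSum Finset.univ (fun j _ =>
    integrable_finsetSum Finset.univ fun k _ => hi i j k),
    fun i j => integral_finsetSum Finset.univ (fun k _ => hi i j k),
    integral_inner_sq_mul_inner_sq_mul_inner_sq_stdGaussian, B.inner_eq_ite]
  simp [Finset.sum_add_distrib, ← Finset.mul_sum, ite_pow]
  ring

end GaussianMoments

/-! ### Lipschitz gradients and the error of the Gaussian estimate. -/

section Smoothness

variable {d : ℕ}

/-- A function whose gradient is `L`-Lipschitz is approximated by its linearization with
quadratic error. -/
lemma abs_sub_linearization_le {h : E d → ℝ} {L : ℝ} (hd : Differentiable ℝ h)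
    (hL : ∀ x y, ‖gradient h x - gradient h y‖ ≤ L * ‖x - y‖) (x v : E d) :
    |h (x + v) - h x - ⟪gradient h x, v⟫| ≤ L / 2 * ‖v‖ ^ 2 := by
  have hφ (t : ℝ) : HasDerivAt (fun t : ℝ => h (x + t • v) - h x - t * ⟪gradient h x, v⟫)
      (⟪gradient h (x + t • v) - gradient h x, v⟫) t := by
    have h1 : HasDerivAt (fun t : ℝ => x + t • v) v t := by
      simpa using ((hasDerivAt_id' t).smul_const v).const_add x
    have h2 := ((hd (x + t • v)).hasGradientAt.hasFDerivAt).comp_hasDerivAt t h1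
    have h3 := (h2.sub_const (h x)).fun_sub ((hasDerivAt_id' t).mul_const ⟪gradient h x, v⟫)
    refine h3.congr_deriv ?_
    simp [inner_sub_left]
  have hB (t : ℝ) : HasDerivAt (fun t : ℝ => L * ‖v‖ ^ 2 * t ^ 2 / 2) (L * ‖v‖ ^ 2 * t) t :=
    (((hasDerivAt_pow 2 t).const_mul (L * ‖v‖ ^ 2)).div_const 2).congr_deriv (by norm_num; ring)
  -- The linearization error along the segment vanishes at `0` and its derivative is at most `L ‖v‖²
  -- t` in absolute value; integrate this bound.
  have := image_norm_le_of_norm_deriv_right_le_deriv_boundary (a := (0 : ℝ)) (b := 1)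
    (fun t _ => (hφ t).continuousAt.continuousWithinAt)
    (fun t _ => (hφ t).hasDerivWithinAt) (B := fun t : ℝ => L * ‖v‖ ^ 2 * t ^ 2 / 2) (by simp)
    (fun t => hB t)
    (fun t ht => by
      rw [Real.norm_eq_abs]
      calc |⟪gradient h (x + t • v) - gradient h x, v⟫|
          ≤ ‖gradient h (x + t • v) - gradient h x‖ * ‖v‖ := abs_real_inner_le_norm _ _
        _ ≤ (L * ‖x + t • v - x‖) * ‖v‖ := by gcongr; exact hL _ _
        _ = L * ‖v‖ ^ 2 * t := by
          rw [add_sub_cancel_left, norm_smul, Real.norm_of_nonneg ht.1]; ring)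
    (Set.right_mem_Icc.2 zero_le_one)
  simp only [Real.norm_eq_abs, one_smul, one_mul] at this
  linarith

/-- The error splits into `⟪g, u⟫ • u - g`, which would be all of it for an affine function, and `r
• u`, where `r` is the Taylor remainder divided by `μ`, of size at most `L μ ‖u‖² / 2`. -/
lemma gauSGE_sub_gradient_norm_sq_le {h : E d → ℝ} {L μ : ℝ} (hμ : 0 < μ)
    (hd : Differentiable ℝ h)
    (hL : ∀ x y, ‖gradient h x - gradient h y‖ ≤ L * ‖x - y‖) (x u : E d) :
    ‖gauSGE μ h x u - gradient h x‖ ^ 2 ≤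
      2 * (⟪gradient h x, u⟫ ^ 2 * ‖u‖ ^ 2 - 2 * ⟪gradient h x, u⟫ ^ 2 + ‖gradient h x‖ ^ 2) +
        L ^ 2 * μ ^ 2 / 2 * ‖u‖ ^ 6 := by
  set g := gradient h x
  set r := (h (x + μ • u) - h x - ⟪g, μ • u⟫) / μ with hr
  have e : gauSGE μ h x u - g = (⟪g, u⟫ • u - g) + r • u := by
    rw [gauSGE, hr, inner_smul_right, sub_div _ (μ * _), mul_div_cancel_left₀ _ hμ.ne',
      sub_smul]
    abel
  have hr2 : r ^ 2 ≤ (L * μ / 2 * ‖u‖ ^ 2) ^ 2 := by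
    apply sq_le_sq'
    all_goals
      have := abs_sub_linearization_le hd hL x (μ • u)
      rw [norm_smul, Real.norm_of_nonneg hμ.le, mul_pow, abs_le] at this
      obtain ⟨h1, h2⟩ := this
    · rw [hr, le_div_iff₀ hμ]; linarith
    · rw [hr, div_le_iff₀ hμ]; linarith
  have h1 : ‖⟪g, u⟫ • u - g‖ ^ 2 = ⟪g, u⟫ ^ 2 * ‖u‖ ^ 2 - 2 * ⟪g, u⟫ ^ 2 + ‖g‖ ^ 2 := by
    rw [norm_sub_sq_real, norm_smul, inner_smul_left, mul_pow, Real.norm_eq_abs, sq_abs,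
      real_inner_comm]
    simp
    ring
  have h2 : ‖r • u‖ ^ 2 = r ^ 2 * ‖u‖ ^ 2 := by
    rw [norm_smul, mul_pow, Real.norm_eq_abs, sq_abs]
  rw [e, ← h1]
  have h3 : ‖(⟪g, u⟫ • u - g) + r • u‖ ^ 2 ≤ 2 * ‖⟪g, u⟫ • u - g‖ ^ 2 + 2 * ‖r • u‖ ^ 2 := by
    have := parallelogram_law_with_norm ℝ (⟪g, u⟫ • u - g) (r • u)
    nlinarith [sq_nonneg ‖(⟪g, u⟫ • u - g) - r • u‖]
  have h4 : r ^ 2 * ‖u‖ ^ 2 ≤ (L * μ / 2 * ‖u‖ ^ 2) ^ 2 * ‖u‖ ^ 2 := by gcongr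
  rw [h2] at h3
  nlinarith

/-- The second moment of the error of the Gaussian smoothing gradient estimate. -/
lemma lintegral_gauSGE_sub_gradient_le {h : E d → ℝ} {L σ μ : ℝ} (hμ : 0 < μ)
    (hd : Differentiable ℝ h)
    (hL : ∀ x y, ‖gradient h x - gradient h y‖ ≤ L * ‖x - y‖)
    (hσ : ∀ x, ‖gradient h x‖ ^ 2 ≤ σ ^ 2) (x : E d) :
    ∫⁻ u, ENNReal.ofReal (‖gauSGE μ h x u - gradient h x‖ ^ 2) ∂(stdGaussian (E d)) ≤
      ENNReal.ofReal ((2 * d + 9) * σ ^ 2 + ((d : ℝ) + 6) ^ 3 * L ^ 2 * μ ^ 2 / 2) := by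
  set g := gradient h x
  have i1 := integrable_inner_sq_mul_norm_sq_stdGaussian g
  have i2 := (integrable_inner_pow_stdGaussian g 2).const_mul 2
  have i3 := integrable_norm_pow_stdGaussian (d := d) 6
  have i6 : Integrable (fun u => ⟪g, u⟫ ^ 2 * ‖u‖ ^ 2 - 2 * ⟪g, u⟫ ^ 2) (stdGaussian (E d)) :=
    i1.sub i2
  have i4 : Integrable (fun u => 2 * (⟪g, u⟫ ^ 2 * ‖u‖ ^ 2 - 2 * ⟪g, u⟫ ^ 2 + ‖g‖ ^ 2))
    (stdGaussian (E d)) := (i6.add (integrable_const _)).const_mul 2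
  have i5 := i3.const_mul (L ^ 2 * μ ^ 2 / 2)
  calc ∫⁻ u, ENNReal.ofReal (‖gauSGE μ h x u - g‖ ^ 2) ∂(stdGaussian (E d))
      ≤ ∫⁻ u, ENNReal.ofReal (2 * (⟪g, u⟫ ^ 2 * ‖u‖ ^ 2 - 2 * ⟪g, u⟫ ^ 2 + ‖g‖ ^ 2) +
        L ^ 2 * μ ^ 2 / 2 * ‖u‖ ^ 6) ∂(stdGaussian (E d)) := by
        gcongr with u
        exact gauSGE_sub_gradient_norm_sq_le hμ hd hL x u
    _ = ENNReal.ofReal (2 * ((d + 2) * ‖g‖ ^ 2 - 2 * ‖g‖ ^ 2 + ‖g‖ ^ 2) +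
        L ^ 2 * μ ^ 2 / 2 * ((d : ℝ) ^ 3 + 6 * (d : ℝ) ^ 2 + 8 * d)) := by
        rw [← ofReal_integral_eq_lintegral_ofReal (i4.fun_add i5)
          (.of_forall fun u => (sq_nonneg _).trans (gauSGE_sub_gradient_norm_sq_le hμ hd hL x u))]
        congr 1
        rw [integral_add i4 i5, integral_const_mul, integral_const_mul,
          integral_add i6 (integrable_const _), integral_sub i1 i2, integral_const_mul,
          integral_inner_sq_mul_norm_sq_stdGaussian, integral_inner_sq_stdGaussian,
          integral_norm_pow_six_stdGaussian]
        simp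
    _ ≤ _ := by
        apply ENNReal.ofReal_le_ofReal
        have h1 : ((d : ℝ) ^ 3 + 6 * (d : ℝ) ^ 2 + 8 * d) ≤ ((d : ℝ) + 6) ^ 3 := by
          have : (0 : ℝ) ≤ d := by positivity
          nlinarith [sq_nonneg (d : ℝ)]
        have h2 : L ^ 2 * μ ^ 2 / 2 * ((d : ℝ) ^ 3 + 6 * (d : ℝ) ^ 2 + 8 * d) ≤
          L ^ 2 * μ ^ 2 / 2 * ((d : ℝ) + 6) ^ 3 := by gcongr
        have h3 : (2 * (d : ℝ) + 2) * ‖g‖ ^ 2 ≤ (2 * d + 9) * σ ^ 2 := by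
          refine mul_le_mul (by linarith) (hσ x) (sq_nonneg _) (by positivity)
        linarith

lemma continuous_gradient_of_lipschitz {h : E d → ℝ} {L : ℝ}
    (hL : ∀ x y, ‖gradient h x - gradient h y‖ ≤ L * ‖x - y‖) : Continuous (gradient h) := by
  refine (LipschitzWith.of_dist_le_mul (K := L.toNNReal) fun x y => ?_).continuous
  rw [dist_eq_norm, dist_eq_norm]
  exact (hL x y).trans (by gcongr; exact Real.le_coe_toNNReal L)

variable {n : ℕ} {f : Fin n → E d → ℝ} {ψ : E d → ℝ} {L σ : ℝ}

lemma Assumptions.hasGradientAt_avgLoss (H : Assumptions f ψ L σ) (x : E d) :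
    HasGradientAt (avgLoss f) ((1 / (n : ℝ)) • ∑ i, gradient (f i) x) x := by
  rw [hasGradientAt_iff_hasFDerivAt, map_smul, map_sum]
  exact (HasFDerivAt.fun_sum fun i _ =>
    (H.differentiable i x).hasGradientAt.hasFDerivAt).const_mul (1 / (n : ℝ))

lemma Assumptions.gradient_avgLoss (H : Assumptions f ψ L σ) (x : E d) :
    gradient (avgLoss f) x = (1 / (n : ℝ)) • ∑ i, gradient (f i) x :=
  (H.hasGradientAt_avgLoss x).gradient

lemma Assumptions.differentiable_avgLoss (H : Assumptions f ψ L σ) :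
    Differentiable ℝ (avgLoss f) :=
  fun x => (H.hasGradientAt_avgLoss x).differentiableAt

lemma Assumptions.lipschitz_avgLoss (H : Assumptions f ψ L σ) (x y : E d) :
    ‖gradient (avgLoss f) x - gradient (avgLoss f) y‖ ≤ L * ‖x - y‖ := by
  have hL := H.L_pos
  rw [H.gradient_avgLoss, H.gradient_avgLoss, ← smul_sub, ← Finset.sum_sub_distrib, norm_smul]
  rcases Nat.eq_zero_or_pos n with hn | hn
  · subst hn; simp; positivity
  have h1 : ‖∑ i, (gradient (f i) x - gradient (f i) y)‖ ≤ n * (L * ‖x - y‖) := by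
    refine (norm_sum_le_of_le _ fun i _ => H.lipschitz i x y).trans ?_
    simp
  have hn' : (0 : ℝ) < n := by exact_mod_cast hn
  rw [Real.norm_of_nonneg (by positivity), one_div, inv_mul_le_iff₀ hn']
  exact h1

end Smoothness

/-! ### The proximal operator of a convex function. -/

section Prox

variable {d : ℕ} {ψ : E d → ℝ} {η : ℝ}

/-- Convexity and a lower bound on the unit sphere around `x` force `ψ` to fall at most linearly, so
the quadratic term makes the sum coercive. Existence is what gives the `epsilon` in `prox` its
meaning. -/
lemma exists_isMinOn_prox (hψ : ConvexOn ℝ Set.univ ψ) (hη : 0 < η) (x : E d) :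
    ∃ y, IsMinOn (fun y' : E d => ψ y' + 1 / (2 * η) * ‖y' - x‖ ^ 2) Set.univ y := by
  have hc : Continuous ψ := by
    rw [← continuousOn_univ]
    exact hψ.continuousOn isOpen_univ
  obtain ⟨m, hm⟩ : ∃ m, ∀ p ∈ Metric.sphere x 1, m ≤ ψ p := by
    obtain ⟨m, hm⟩ := ((isCompact_sphere x 1).image hc).bddBelow
    exact ⟨m, fun p hp => hm ⟨p, hp, rfl⟩⟩
  set C := max (ψ x - m) 0 with hC
  have hlow : ∀ y, 1 ≤ ‖y - x‖ → ψ x - C * ‖y - x‖ ≤ ψ y := by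
    intro y hy
    set r := ‖y - x‖ with hr
    have hr0 : 0 < r := by linarith
    have hp : x + r⁻¹ • (y - x) ∈ Metric.sphere x 1 := by
      rw [mem_sphere_iff_norm, add_sub_cancel_left, norm_smul, ← hr, norm_inv,
        Real.norm_of_nonneg hr0.le, inv_mul_cancel₀ hr0.ne']
    have hcv := hψ.2 (Set.mem_univ x) (Set.mem_univ y)
      (show 0 ≤ 1 - r⁻¹ by rw [sub_nonneg]; exact inv_le_one_of_one_le₀ hy) (show 0 ≤ r⁻¹ by positivity) (by ring)
    have e : (1 - r⁻¹) • x + r⁻¹ • y = x + r⁻¹ • (y - x) := by module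
    rw [e] at hcv
    have h1 := (hm _ hp).trans hcv
    have h2 : r * m ≤ (r - 1) * ψ x + ψ y := by
      have := mul_le_mul_of_nonneg_left h1 hr0.le
      simp only [smul_eq_mul] at this
      have e2 : r * ((1 - r⁻¹) * ψ x + r⁻¹ * ψ y) = (r - 1) * ψ x + ψ y := by
        field_simp
      linarith
    have h3 : (ψ x - m) * r ≤ C * r := by gcongr; exact le_max_left _ _
    linarith
  obtain ⟨y, hy⟩ := Continuous.exists_forall_le'
    (f := fun y' : E d => ψ y' + 1 / (2 * η) * ‖y' - x‖ ^ 2) (by fun_prop) x (by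
      have hcomp := (isCompact_closedBall x (max 1 (2 * η * C))).compl_mem_cocompact
      filter_upwards [hcomp] with y hy
      rw [Set.mem_compl_iff, mem_closedBall_iff_norm, not_le, max_lt_iff] at hy
      have h1 := hlow y hy.1.le
      have h2 : C * ‖y - x‖ ≤ 1 / (2 * η) * ‖y - x‖ ^ 2 := by
        rw [one_div, inv_mul_eq_div, le_div_iff₀ (by positivity)]
        nlinarith [hy.1, hy.2]
      simp only [sub_self, norm_zero]
      linarith)
  exact ⟨y, fun z _ => hy z⟩

lemma prox_isMinOn (hψ : ConvexOn ℝ Set.univ ψ) (hη : 0 < η) (x z : E d) :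
    ψ (prox η ψ x) + 1 / (2 * η) * ‖prox η ψ x - x‖ ^ 2 ≤ ψ z + 1 / (2 * η) * ‖z - x‖ ^ 2 :=
  Classical.epsilon_spec (exists_isMinOn_prox hψ hη x) (Set.mem_univ z)

/-- The three-point inequality of the proximal operator. -/
lemma prox_three_point (hψ : ConvexOn ℝ Set.univ ψ) (hη : 0 < η) (x z : E d) :
    ψ (prox η ψ x) + 1 / (2 * η) * ‖prox η ψ x - x‖ ^ 2 + 1 / (2 * η) * ‖z - prox η ψ x‖ ^ 2 ≤
      ψ z + 1 / (2 * η) * ‖z - x‖ ^ 2 := by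
  set y := prox η ψ x with hy
  set q := 1 / (2 * η)
  -- Test minimality against the point `(1 - t) y + t z`, divide by `t` and let `t → 0`.
  have key : ∀ t ∈ Set.Ioo (0 : ℝ) 1,
      ψ y + q * ‖y - x‖ ^ 2 + (1 - t) * (q * ‖z - y‖ ^ 2) ≤ ψ z + q * ‖z - x‖ ^ 2 := by
    intro t ht
    have h1 := prox_isMinOn hψ hη x ((1 - t) • y + t • z)
    rw [← hy] at h1
    have h2 := hψ.2 (Set.mem_univ y) (Set.mem_univ z)
      (show 0 ≤ 1 - t by linarith [ht.2]) ht.1.le (by ring)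
    simp only [smul_eq_mul] at h2
    have h3 : ‖(1 - t) • y + t • z - x‖ ^ 2 =
        (1 - t) * ‖y - x‖ ^ 2 + t * ‖z - x‖ ^ 2 - t * (1 - t) * ‖z - y‖ ^ 2 := by
      have e1 : (1 - t) • y + t • z - x = (y - x) + t • (z - y) := by module
      have e2 : z - x = (y - x) + (z - y) := by abel
      rw [e1, e2, norm_add_sq_real, norm_add_sq_real, inner_smul_right, norm_smul, mul_pow,
        Real.norm_eq_abs, sq_abs]
      ring
    rw [h3] at h1
    have h4 : t * (ψ y + q * ‖y - x‖ ^ 2 + (1 - t) * (q * ‖z - y‖ ^ 2)) ≤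
        t * (ψ z + q * ‖z - x‖ ^ 2) := by
      change ψ y + q * ‖y - x‖ ^ 2 ≤ _ + q * _ at h1
      linarith
    exact le_of_mul_le_mul_left h4 ht.1
  have hlim : Filter.Tendsto (fun t : ℝ => ψ y + q * ‖y - x‖ ^ 2 + (1 - t) * (q * ‖z - y‖ ^ 2))
      (nhdsWithin 0 (Set.Ioi 0)) (nhds (ψ y + q * ‖y - x‖ ^ 2 + q * ‖z - y‖ ^ 2)) := by
    have : Continuous (fun t : ℝ => ψ y + q * ‖y - x‖ ^ 2 + (1 - t) * (q * ‖z - y‖ ^ 2)) := by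
      fun_prop
    simpa using (this.tendsto 0).mono_left nhdsWithin_le_nhds
  exact le_of_tendsto hlim (Filter.mem_of_superset (Ioo_mem_nhdsGT zero_lt_one) key)

/-- Adding the three-point inequalities at both points cancels `ψ` and leaves `‖y - y'‖² ≤ ⟪y - y',
x - x'⟫`. It supplies the continuity behind the measurability of the iterates. -/
lemma lipschitzWith_prox (hψ : ConvexOn ℝ Set.univ ψ) (hη : 0 < η) :
    LipschitzWith 1 (prox η ψ) := by
  refine LipschitzWith.of_dist_le_mul fun x x' => ?_
  rw [dist_eq_norm, dist_eq_norm, NNReal.coe_one, one_mul]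
  have h1 := prox_three_point hψ hη x (prox η ψ x')
  have h2 := prox_three_point hψ hη x' (prox η ψ x)
  set y := prox η ψ x
  set y' := prox η ψ x'
  have hq : 0 < 1 / (2 * η) := by positivity
  have h3 : ‖y - x‖ ^ 2 + ‖y' - y‖ ^ 2 + (‖y' - x'‖ ^ 2 + ‖y - y'‖ ^ 2) ≤
      ‖y' - x‖ ^ 2 + ‖y - x'‖ ^ 2 := by
    refine le_of_mul_le_mul_left ?_ hq
    linarith
  have e : ‖y' - x‖ ^ 2 + ‖y - x'‖ ^ 2 - ‖y - x‖ ^ 2 - ‖y' - x'‖ ^ 2 = 2 * ⟪y - y', x - x'⟫ := by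
    rw [norm_sub_sq_real, norm_sub_sq_real, norm_sub_sq_real, norm_sub_sq_real, inner_sub_left,
      inner_sub_right, inner_sub_right]
    ring
  have h4 : ‖y - y'‖ ^ 2 ≤ ‖y - y'‖ * ‖x - x'‖ := by
    have := real_inner_le_norm (y - y') (x - x')
    rw [norm_sub_rev y' y] at h3
    linarith
  by_contra! hlt
  have : 0 ≤ ‖x - x'‖ := norm_nonneg _
  nlinarith

end Prox

/-! ### Descent of the objective in an inexact proximal step. -/

section Descent

variable {d n : ℕ} {f : Fin n → E d → ℝ} {ψ : E d → ℝ} {L σ η : ℝ}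

/-- One proximal step with an inexact gradient `v`. -/
lemma objective_prox_step_le (H : Assumptions f ψ L σ) (hη : 0 < η) (x v : E d) :
    objective f ψ (prox η ψ (x - η • v)) + η / 2 * ‖gradMap η f ψ x‖ ^ 2 +
        (1 / (2 * η) - L / 2) * ‖prox η ψ (x - η • v) - x‖ ^ 2 ≤
      objective f ψ x + η / 2 * ‖gradient (avgLoss f) x - v‖ ^ 2 := by
  set g := gradient (avgLoss f) x with hg
  set y := prox η ψ (x - η • v) with hy
  set z := prox η ψ (x - η • g) with hz
  -- The exact step `z` is tested against `x`, the actual step `y` against `z`; in the sum `ψ z` and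
  -- one of two copies of `‖z - x‖²` cancel. The other copy is the gradient mapping.
  have h1 := prox_three_point H.convex hη (x - η • g) x
  have h2 := prox_three_point H.convex hη (x - η • v) z
  have h3 := (abs_le.1 (abs_sub_linearization_le H.differentiable_avgLoss H.lipschitz_avgLoss
    x (y - x))).2
  rw [← hz] at h1
  rw [← hy] at h2
  rw [add_sub_cancel, ← hg] at h3
  have hgm : ‖gradMap η f ψ x‖ ^ 2 = 1 / η ^ 2 * ‖z - x‖ ^ 2 := by
    rw [gradMap, ← hg, ← hz, norm_smul, mul_pow, norm_sub_rev, Real.norm_eq_abs, sq_abs]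
    ring
  have exp (p w : E d) : 1 / (2 * η) * ‖p - (x - η • w)‖ ^ 2 =
      1 / (2 * η) * ‖p - x‖ ^ 2 + ⟪w, p - x⟫ + η / 2 * ‖w‖ ^ 2 := by
    rw [show p - (x - η • w) = (p - x) + η • w by abel, norm_add_sq_real, inner_smul_right,
      norm_smul, mul_pow, Real.norm_eq_abs, sq_abs, real_inner_comm]
    field_simp
  rw [exp, exp, sub_self, inner_zero_right, norm_zero, norm_sub_rev x z] at h1
  rw [exp, exp] at h2
  -- The weight makes the `‖y - z‖²` term equal to the surplus in `h2`.
  have hyoung : ⟪g - v, y - z⟫ ≤ η / 2 * ‖g - v‖ ^ 2 + 1 / (2 * η) * ‖y - z‖ ^ 2 := by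
    have := real_inner_le_norm (g - v) (y - z)
    have h5 : 0 ≤ 1 / (2 * η) * (η * ‖g - v‖ - ‖y - z‖) ^ 2 := by positivity
    have e : 1 / (2 * η) * (η * ‖g - v‖ - ‖y - z‖) ^ 2 =
      η / 2 * ‖g - v‖ ^ 2 - ‖g - v‖ * ‖y - z‖ + 1 / (2 * η) * ‖y - z‖ ^ 2 := by
      field_simp
      ring
    linarith
  have hin : ⟪g - v, y - z⟫ = ⟪g, y - x⟫ - ⟪g, z - x⟫ - ⟪v, y - x⟫ + ⟪v, z - x⟫ := by
    simp only [inner_sub_left, inner_sub_right]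
    ring
  have hη2 : η / 2 * (1 / η ^ 2 * ‖z - x‖ ^ 2) = 1 / (2 * η) * ‖z - x‖ ^ 2 := by
    field_simp
  rw [hgm, hη2, objective, objective]
  rw [norm_sub_rev z y] at h2
  linarith

end Descent

/-! ### Averages over mini-batches drawn with replacement. -/

section IndexAverage

/-- The average over all mini-batches `I : Fin b → Fin n`. -/
def indexAvg {n b : ℕ} (H : (Fin b → Fin n) → ℝ) : ℝ :=
  ((n : ℝ) ^ b)⁻¹ * ∑ I, H I

variable {n b : ℕ}

lemma indexAvg_add (H K : (Fin b → Fin n) → ℝ) :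
    indexAvg (fun I => H I + K I) = indexAvg H + indexAvg K := by
  rw [indexAvg, Finset.sum_add_distrib, mul_add]; rfl

lemma indexAvg_const_mul (c : ℝ) (H : (Fin b → Fin n) → ℝ) :
    indexAvg (fun I => c * H I) = c * indexAvg H := by
  rw [indexAvg, ← Finset.mul_sum, indexAvg]; ring

lemma indexAvg_sum {ι : Type*} (s : Finset ι) (H : ι → (Fin b → Fin n) → ℝ) :
    indexAvg (fun I => ∑ i ∈ s, H i I) = ∑ i ∈ s, indexAvg (H i) := by
  simp only [indexAvg]
  rw [Finset.sum_comm, Finset.mul_sum]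

lemma indexAvg_mono {H K : (Fin b → Fin n) → ℝ} (h : ∀ I, H I ≤ K I) :
    indexAvg H ≤ indexAvg K := by
  unfold indexAvg
  gcongr with I
  exact h I

lemma indexAvg_const (hn : 0 < n) (c : ℝ) : indexAvg (fun _ : Fin b → Fin n => c) = c := by
  have : (n : ℝ) ^ b ≠ 0 := by positivity
  simp [indexAvg, this]

/-- The probability that a given index does not occur in the mini-batch. -/
lemma indexAvg_notMem (hn : 0 < n) (i : Fin n) :
    indexAvg (fun I : Fin b → Fin n => if i ∈ Finset.univ.image I then (0 : ℝ) else 1) =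
      (1 - 1 / (n : ℝ)) ^ b := by
  have h1 (I : Fin b → Fin n) : (if i ∈ Finset.univ.image I then (0 : ℝ) else 1) =
      ∏ k, if I k = i then 0 else 1 := by
    split_ifs with h
    · obtain ⟨k, -, hk⟩ := Finset.mem_image.1 h
      exact (Finset.prod_eq_zero (Finset.mem_univ k) (by simp [hk])).symm
    · rw [Finset.prod_eq_one]
      intro k _
      rw [if_neg]
      exact fun hk => h (Finset.mem_image.2 ⟨k, Finset.mem_univ k, hk⟩)
  have h2 : ∑ j : Fin n, (if j = i then (0 : ℝ) else 1) = n - 1 := by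
    have : ∀ j : Fin n, (if j = i then (0 : ℝ) else 1) = 1 - if j = i then 1 else 0 := by
      intro j; split_ifs <;> simp
    simp [this]
  simp_rw [indexAvg, h1]
  -- Missing `i` is a product over the draws, so the sum over batches factors.
  rw [← Fintype.piFinset_univ, ← Finset.prod_univ_sum (fun _ => Finset.univ)
    (fun (_ : Fin b) (j : Fin n) => if j = i then (0 : ℝ) else 1), h2]
  have : (n : ℝ) ≠ 0 := by positivity
  rw [Finset.prod_const, Finset.card_univ, Fintype.card_fin, ← inv_pow, ← mul_pow]
  congr 1
  field_simp

/-- With `x = 1/n`, Bernoulli's inequality and `(1 - x)^b (1 + x)^b ≤ 1` give `(1 - x)^b ≤ 1 / (1 +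
b x)`, which is at most `1 - b x / 2` because `b x ≤ 1`. -/
lemma one_sub_inv_pow_le (hb : b ≤ n) (hn : 0 < n) :
    (1 - 1 / (n : ℝ)) ^ b ≤ 1 - b / (2 * n) := by
  have hn' : (1 : ℝ) ≤ n := by exact_mod_cast hn
  have hbn : (b : ℝ) ≤ n := by exact_mod_cast hb
  set x := 1 / (n : ℝ) with hx
  have hx0 : 0 ≤ x := by positivity
  have hx1 : x ≤ 1 := by rw [hx, div_le_one (by linarith)]; exact hn'
  have hbx : b * x ≤ 1 := by rw [hx, mul_one_div, div_le_one (by linarith)]; exact hbn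
  have hbx0 : 0 ≤ b * x := by positivity
  have h1 : 1 + b * x ≤ (1 + x) ^ b := one_add_mul_le_pow (by linarith) b
  have h2 : (1 - x) ^ b * (1 + x) ^ b ≤ 1 := by
    rw [← mul_pow]
    exact pow_le_one₀ (by nlinarith) (by nlinarith)
  have h3 : 0 ≤ (1 - x) ^ b := pow_nonneg (by linarith) b
  have h4 : (1 - x) ^ b * (1 + b * x) ≤ 1 := (mul_le_mul_of_nonneg_left h1 h3).trans h2
  have h5 : (b : ℝ) / (2 * n) = b * x / 2 := by rw [hx]; field_simp
  rw [h5]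
  by_contra! hlt
  have : (1 - b * x / 2) * (1 + b * x) < (1 - x) ^ b * (1 + b * x) := by gcongr
  nlinarith

variable {V : Type*} [NormedAddCommGroup V]

/-- Young's inequality with weights `3/2` and `3`, then `(‖q‖ + ‖r‖)² ≤ 2‖q‖² + 2‖r‖²`. The small
weight on `p` keeps the step-size condition mild. -/
lemma norm_add_sub_sq_le (p q r : V) :
    ‖p + (q - r)‖ ^ 2 ≤ 3 / 2 * ‖p‖ ^ 2 + 6 * ‖q‖ ^ 2 + 6 * ‖r‖ ^ 2 := by
  have h1 : ‖p + (q - r)‖ ^ 2 ≤ (‖p‖ + (‖q‖ + ‖r‖)) ^ 2 := by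
    gcongr
    exact (norm_add_le _ _).trans (by gcongr; exact norm_sub_le _ _)
  nlinarith [sq_nonneg (‖p‖ - 2 * (‖q‖ + ‖r‖)), sq_nonneg (‖q‖ - ‖r‖)]

lemma norm_add_sq_le_of_pos {β : ℝ} (hβ : 0 < β) (p q : V) :
    ‖p + q‖ ^ 2 ≤ (1 + 1 / β) * ‖p‖ ^ 2 + (1 + β) * ‖q‖ ^ 2 := by
  have h1 : ‖p + q‖ ^ 2 ≤ (‖p‖ + ‖q‖) ^ 2 := by
    gcongr
    exact norm_add_le _ _
  have h2 : 0 ≤ 1 / β * (‖p‖ - β * ‖q‖) ^ 2 := by positivity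
  have h3 : 1 / β * (‖p‖ - β * ‖q‖) ^ 2 = 1 / β * ‖p‖ ^ 2 - 2 * ‖p‖ * ‖q‖ + β * ‖q‖ ^ 2 := by
    field_simp
    ring
  linarith

variable [InnerProductSpace ℝ V]

/-- Independent centred draws have no cross terms. The induction on the number of draws absorbs the
first draw into `e`, so `e` must be general. -/
lemma sum_norm_add_sum_sq (hn : 0 < n) (c : Fin n → V) (hc : ∑ i, c i = 0) (e : V) :
    ∑ I : Fin b → Fin n, ‖e + ∑ k, c (I k)‖ ^ 2 =
      (n : ℝ) ^ b * (‖e‖ ^ 2 + b / n * ∑ i, ‖c i‖ ^ 2) := by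
  have hn' : (n : ℝ) ≠ 0 := by positivity
  induction b generalizing e with
  | zero => simp
  | succ b ih =>
    rw [← (Fin.consEquiv fun _ : Fin (b + 1) => Fin n).sum_comp, Fintype.sum_prod_type]
    simp only [Fin.consEquiv_apply, Fin.sum_univ_succ, Fin.cons_zero, Fin.cons_succ, ← add_assoc,
      ih]
    rw [← Finset.mul_sum, Finset.sum_add_distrib]
    simp_rw [norm_add_sq_real]
    rw [Finset.sum_add_distrib, Finset.sum_add_distrib, ← Finset.mul_sum, ← inner_sum, hc,
      inner_zero_right]
    simp only [Finset.sum_const, Finset.card_univ, Fintype.card_fin, nsmul_eq_mul]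
    push_cast
    field_simp
    ring

/-- Bias-variance decomposition of a mini-batch mean. -/
lemma indexAvg_norm_sq_le (hn : 0 < n) (hb : 0 < b) (a : Fin n → V) (e : V) :
    indexAvg (fun I : Fin b → Fin n =>
        ‖e + ((1 / (b : ℝ)) • ∑ k, a (I k) - (1 / (n : ℝ)) • ∑ i, a i)‖ ^ 2) ≤
      ‖e‖ ^ 2 + 1 / b * (1 / n * ∑ i, ‖a i‖ ^ 2) := by
  have hn' : (n : ℝ) ≠ 0 := by positivity
  have hb' : (b : ℝ) ≠ 0 := by positivity
  set m := (1 / (n : ℝ)) • ∑ i, a i with hm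
  have hma : ∑ i, a i = (n : ℝ) • m := by rw [hm, smul_smul, mul_one_div_cancel hn', one_smul]
  set c : Fin n → V := fun i => (1 / (b : ℝ)) • (a i - m) with hc
  have hc0 : ∑ i, c i = 0 := by
    simp only [hc]
    rw [← Finset.smul_sum, Finset.sum_sub_distrib, hma]
    simp [← Nat.cast_smul_eq_nsmul ℝ]
  have h1 (I : Fin b → Fin n) : (1 / (b : ℝ)) • ∑ k, a (I k) - m = ∑ k, c (I k) := by
    simp only [hc]
    rw [← Finset.smul_sum, Finset.sum_sub_distrib, smul_sub]
    simp [← Nat.cast_smul_eq_nsmul ℝ, smul_smul, hb']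
  have h2 : ∑ i, ‖c i‖ ^ 2 ≤ 1 / (b : ℝ) ^ 2 * ∑ i, ‖a i‖ ^ 2 := by
    have h3 (i : Fin n) : ‖c i‖ ^ 2 =
        1 / (b : ℝ) ^ 2 * (‖a i‖ ^ 2 - 2 * ⟪a i, m⟫ + ‖m‖ ^ 2) := by
      simp only [hc]
      rw [norm_smul, mul_pow, norm_sub_sq_real, Real.norm_eq_abs, sq_abs]
      ring
    simp_rw [h3]
    rw [← Finset.mul_sum, Finset.sum_add_distrib, Finset.sum_sub_distrib, ← Finset.mul_sum,
      ← sum_inner, hma, inner_smul_left, real_inner_self_eq_norm_sq]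
    refine mul_le_mul_of_nonneg_left ?_ (by positivity)
    simp only [Finset.sum_const, Finset.card_univ, Fintype.card_fin, nsmul_eq_mul]
    have : (0 : ℝ) ≤ n * ‖m‖ ^ 2 := by positivity
    simp
    linarith
  simp_rw [h1]
  rw [indexAvg, sum_norm_add_sum_sq hn c hc0, inv_mul_cancel_left₀ (by positivity)]
  have h4 : (b : ℝ) / n * ∑ i, ‖c i‖ ^ 2 ≤ b / n * (1 / (b : ℝ) ^ 2 * ∑ i, ‖a i‖ ^ 2) := by
    gcongr
  have h5 : (b : ℝ) / n * (1 / (b : ℝ) ^ 2 * ∑ i, ‖a i‖ ^ 2) = 1 / b * (1 / n * ∑ i, ‖a i‖ ^ 2) := by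
    field_simp
  linarith

lemma norm_mean_sq_le (hn : 0 < n) (a : Fin n → V) :
    ‖(1 / (n : ℝ)) • ∑ i, a i‖ ^ 2 ≤ 1 / n * ∑ i, ‖a i‖ ^ 2 := by
  have hn' : (n : ℝ) ≠ 0 := by positivity
  have h1 : ‖∑ i, a i‖ ^ 2 ≤ n * ∑ i, ‖a i‖ ^ 2 := by
    calc ‖∑ i, a i‖ ^ 2 ≤ (∑ i, ‖a i‖) ^ 2 := by gcongr; exact norm_sum_le _ _
      _ ≤ _ := by simpa using sq_sum_le_card_mul_sum_sq (s := Finset.univ) (f := fun i => ‖a i‖)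
  rw [norm_smul, mul_pow, Real.norm_eq_abs, sq_abs]
  calc (1 / (n : ℝ)) ^ 2 * ‖∑ i, a i‖ ^ 2 ≤ (1 / (n : ℝ)) ^ 2 * (n * ∑ i, ‖a i‖ ^ 2) := by gcongr
    _ = _ := by field_simp

end IndexAverage

/-! ### One iteration, averaged over its mini-batch. -/

section OneStep

variable {d n b : ℕ} {f : Fin n → E d → ℝ} {ψ : E d → ℝ} {L σ η μ : ℝ}

/-- `φ` is the average of the stored gradient estimates. -/
def State.Consistent (f : Fin n → E d → ℝ) (μ : ℝ) (s : State d n) : Prop :=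
  s.φ = (1 / (n : ℝ)) • ∑ i, gauSGE μ (f i) (s.z i) (s.w i)

lemma State.consistent_init (x₀ : E d) (u : Fin n → E d) :
    (State.init f μ x₀ u).Consistent f μ := rfl

/-- The update of `φ` runs over the set of drawn indices, so a repeated index changes the average
once, exactly as it changes the table once. -/
lemma State.Consistent.step {s : State d n} (hs : s.Consistent f μ) (I : Fin b → Fin n)
    (u : Fin n → E d) : (s.step f ψ μ η I u).Consistent f μ := by
  unfold State.Consistent at *
  rw [State.step, hs, ← smul_sub]
  dsimp only
  congr 1
  have h := Finset.sum_ite_mem Finset.univ (Finset.univ.image I)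
    (fun i => (gauSGE μ (f i) (s.z i) (s.w i) - gauSGE μ (f i) s.x (u i) : E d))
  rw [Finset.univ_inter] at h
  rw [← h, ← Finset.sum_sub_distrib]
  refine Finset.sum_congr rfl fun i _ => ?_
  split_ifs <;> simp

lemma run_consistent (x₀ : E d) (I : ℕ → Fin b → Fin n) (U : ℕ → Fin n → E d) (t : ℕ) :
    (run f ψ μ η x₀ I U t).Consistent f μ := by
  induction t with
  | zero => exact State.consistent_init _ _
  | succ t ih => exact ih.step _ _

/-- The mean squared error of the stored gradient estimates. -/
def State.tableErr (f : Fin n → E d → ℝ) (μ : ℝ) (s : State d n) : ℝ :=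
  1 / (n : ℝ) * ∑ i, ‖gauSGE μ (f i) (s.z i) (s.w i) - gradient (f i) (s.z i)‖ ^ 2

/-- The mean squared error of fresh gradient estimates at `x`. -/
def freshErr (f : Fin n → E d → ℝ) (μ : ℝ) (x : E d) (u : Fin n → E d) : ℝ :=
  1 / (n : ℝ) * ∑ i, ‖gauSGE μ (f i) x (u i) - gradient (f i) x‖ ^ 2

/-- The Lyapunov function: suboptimality plus the weighted mean squared distance to the
reference points. -/
def State.lyapunov (f : Fin n → E d → ℝ) (ψ : E d → ℝ) (Fmin c : ℝ) (s : State d n) : ℝ :=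
  objective f ψ s.x - Fmin + c * (1 / (n : ℝ) * ∑ i, ‖s.x - s.z i‖ ^ 2)

/-- Each table entry survives with probability `(1 - 1/n)^b` and is otherwise replaced by a fresh
one. Being a convex combination, the average preserves a common bound. -/
lemma indexAvg_tableErr_step (hn : 0 < n) (s : State d n) (u : Fin n → E d) :
    indexAvg (fun I : Fin b → Fin n => (s.step f ψ μ η I u).tableErr f μ) =
      (1 - 1 / (n : ℝ)) ^ b * s.tableErr f μ +
        (1 - (1 - 1 / (n : ℝ)) ^ b) * freshErr f μ s.x u := by
  set p := fun i => ‖gauSGE μ (f i) (s.z i) (s.w i) - gradient (f i) (s.z i)‖ ^ 2 with hp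
  set q := fun i => ‖gauSGE μ (f i) s.x (u i) - gradient (f i) s.x‖ ^ 2 with hq
  have h (I : Fin b → Fin n) : (s.step f ψ μ η I u).tableErr f μ =
      1 / (n : ℝ) * ∑ i, (q i +
        (p i - q i) * if i ∈ Finset.univ.image I then (0 : ℝ) else 1) := by
    rw [State.tableErr]
    congr 1
    refine Finset.sum_congr rfl fun i _ => ?_
    by_cases hi : i ∈ Finset.univ.image I
    · simp only [State.step, if_pos hi, hp, hq]; ring
    · simp only [State.step, if_neg hi, hp, hq]; ring
  simp_rw [h]
  rw [indexAvg_const_mul, indexAvg_sum]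
  simp_rw [indexAvg_add, indexAvg_const_mul, indexAvg_const hn, indexAvg_notMem hn]
  rw [State.tableErr, freshErr, Finset.sum_add_distrib, ← Finset.sum_mul, Finset.sum_sub_distrib]
  ring

/-- By consistency the batch mean of `v` is the mean of the fresh estimates, so the bias `e` is
their mean error. In the variance, fresh minus stored estimate is a gradient difference plus two
estimation errors. -/
lemma Assumptions.indexAvg_norm_v_sub_gradient_sq_le (H : Assumptions f ψ L σ) (hn : 0 < n)
    (hb : 0 < b) {s : State d n} (hs : s.Consistent f μ) (u : Fin n → E d) :
    indexAvg (fun I : Fin b → Fin n => ‖gradient (avgLoss f) s.x - s.v f μ I u‖ ^ 2) ≤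
      (1 + 6 / b) * freshErr f μ s.x u + 6 / b * s.tableErr f μ +
        3 * L ^ 2 / (2 * b) * (1 / n * ∑ i, ‖s.x - s.z i‖ ^ 2) := by
  set a := fun i => gauSGE μ (f i) s.x (u i) with ha
  set h := fun i => gauSGE μ (f i) (s.z i) (s.w i) with hh
  set e := (1 / (n : ℝ)) • ∑ i, (a i - gradient (f i) s.x) with he
  have h1 (I : Fin b → Fin n) : ‖gradient (avgLoss f) s.x - s.v f μ I u‖ ^ 2 =
      ‖e + ((1 / (b : ℝ)) • ∑ k, (a (I k) - h (I k)) -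
        (1 / (n : ℝ)) • ∑ i, (a i - h i))‖ ^ 2 := by
    rw [norm_sub_rev, State.v, hs, H.gradient_avgLoss, he]
    simp only [Finset.sum_sub_distrib, smul_sub, ha, hh]
    congr 2
    abel
  simp_rw [h1]
  refine (indexAvg_norm_sq_le hn hb (fun i => a i - h i) e).trans ?_
  have h2 : ‖e‖ ^ 2 ≤ freshErr f μ s.x u := norm_mean_sq_le hn _
  have h3 : 1 / (n : ℝ) * ∑ i, ‖a i - h i‖ ^ 2 ≤ 3 / 2 * L ^ 2 * (1 / n * ∑ i, ‖s.x - s.z i‖ ^ 2) +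
      6 * freshErr f μ s.x u + 6 * s.tableErr f μ := by
    have h4 (i : Fin n) : ‖a i - h i‖ ^ 2 ≤ 3 / 2 * L ^ 2 * ‖s.x - s.z i‖ ^ 2 +
        6 * ‖a i - gradient (f i) s.x‖ ^ 2 + 6 * ‖h i - gradient (f i) (s.z i)‖ ^ 2 := by
      have h5 := norm_add_sub_sq_le (gradient (f i) s.x - gradient (f i) (s.z i))
        (a i - gradient (f i) s.x) (h i - gradient (f i) (s.z i))
      have h6 : ‖gradient (f i) s.x - gradient (f i) (s.z i)‖ ^ 2 ≤ (L * ‖s.x - s.z i‖) ^ 2 := by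
        gcongr
        exact H.lipschitz i _ _
      rw [show gradient (f i) s.x - gradient (f i) (s.z i) + (a i - gradient (f i) s.x -
        (h i - gradient (f i) (s.z i))) = a i - h i by abel] at h5
      rw [mul_pow] at h6
      linarith
    have h7 := Finset.sum_le_sum fun i (_ : i ∈ Finset.univ) => h4 i
    rw [Finset.sum_add_distrib, Finset.sum_add_distrib, ← Finset.mul_sum, ← Finset.mul_sum,
      ← Finset.mul_sum] at h7
    rw [freshErr, State.tableErr]
    have h8 := mul_le_mul_of_nonneg_left h7 (show 0 ≤ 1 / (n : ℝ) by positivity)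
    linarith
  have h9 := mul_le_mul_of_nonneg_left h3 (show 0 ≤ 1 / (b : ℝ) by positivity)
  have h10 : 1 / (b : ℝ) * (3 / 2 * L ^ 2 * (1 / n * ∑ i, ‖s.x - s.z i‖ ^ 2) +
      6 * freshErr f μ s.x u + 6 * s.tableErr f μ) =
      6 / b * freshErr f μ s.x u + 6 / b * s.tableErr f μ +
        3 * L ^ 2 / (2 * b) * (1 / n * ∑ i, ‖s.x - s.z i‖ ^ 2) := by
    have hb' : (b : ℝ) ≠ 0 := by positivity
    field_simp
    ring
  linarith

/-- A refreshed reference point lies at the old iterate, one step length away; for the others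
Young's inequality splits off that step. -/
lemma sum_norm_step_sub_sq_le {β : ℝ} (hβ : 0 < β) (hn : 0 < n) (s : State d n)
    (I : Fin b → Fin n) (u : Fin n → E d) :
    1 / (n : ℝ) * ∑ i, ‖(s.step f ψ μ η I u).x - (s.step f ψ μ η I u).z i‖ ^ 2 ≤
      (1 + 1 / β) * ‖prox η ψ (s.x - η • s.v f μ I u) - s.x‖ ^ 2 +
        (1 + β) * (1 / (n : ℝ) * ∑ i, ‖s.x - s.z i‖ ^ 2 *
          if i ∈ Finset.univ.image I then (0 : ℝ) else 1) := by
  set y := prox η ψ (s.x - η • s.v f μ I u) with hy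
  have h1 (i : Fin n) : ‖(s.step f ψ μ η I u).x - (s.step f ψ μ η I u).z i‖ ^ 2 ≤
      (1 + 1 / β) * ‖y - s.x‖ ^ 2 + (1 + β) * (‖s.x - s.z i‖ ^ 2 *
          if i ∈ Finset.univ.image I then (0 : ℝ) else 1) := by
    by_cases hi : i ∈ Finset.univ.image I
    · simp only [State.step, if_pos hi, ← hy, mul_zero, add_zero]
      have : 0 ≤ 1 / β * ‖y - s.x‖ ^ 2 := by positivity
      linarith
    · simp only [State.step, if_neg hi, ← hy, mul_one]
      have := norm_add_sq_le_of_pos hβ (y - s.x) (s.x - s.z i)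
      rwa [sub_add_sub_cancel] at this
  have h2 := mul_le_mul_of_nonneg_left (Finset.sum_le_sum fun i (_ : i ∈ Finset.univ) => h1 i)
    (show 0 ≤ 1 / (n : ℝ) by positivity)
  refine h2.trans_eq ?_
  have hn' : (n : ℝ) ≠ 0 := by positivity
  rw [Finset.sum_add_distrib, Finset.sum_const, Finset.card_univ,
    Fintype.card_fin, nsmul_eq_mul, mul_add, ← mul_assoc, one_div_mul_cancel hn', one_mul,
    ← Finset.mul_sum]
  ring

/-- The expected decrease of the Lyapunov function over the draw of the mini-batch. -/
lemma Assumptions.indexAvg_lyapunov_step_le (H : Assumptions f ψ L σ) (hb : 0 < b) (hbn : b ≤ n)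
    (hη : 0 < η) (hcond : 30 * (η * L) ^ 2 * (n : ℝ) ^ 2 / (b : ℝ) ^ 3 + η * L ≤ 1) {c : ℝ}
    (hc : c = 3 * η * L ^ 2 * n / (b : ℝ) ^ 2) (Fmin : ℝ)
    {s : State d n} (hs : s.Consistent f μ) (u : Fin n → E d) :
    indexAvg (fun I : Fin b → Fin n => (s.step f ψ μ η I u).lyapunov f ψ Fmin c) +
        η / 2 * ‖gradMap η f ψ s.x‖ ^ 2 ≤
      s.lyapunov f ψ Fmin c +
        η / 2 * ((1 + 6 / b) * freshErr f μ s.x u + 6 / b * s.tableErr f μ) := by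
  have hn : 0 < n := hb.trans_le hbn
  have hL := H.L_pos
  have hb' : (0 : ℝ) < b := by exact_mod_cast hb
  have hn' : (0 : ℝ) < n := by exact_mod_cast hn
  have hbn' : (b : ℝ) ≤ n := by exact_mod_cast hbn
  have hc0 : 0 ≤ c := by rw [hc]; positivity
  -- With this `β` the survival probability is at most `1 - 2β`, and `(1 + β)(1 - 2β) ≤ 1 - β`.
  set β : ℝ := b / (4 * n) with hβ
  have hβ0 : 0 < β := by positivity
  set r := fun i => ‖s.x - s.z i‖ ^ 2 with hr
  set S := 1 / (n : ℝ) * ∑ i, r i with hS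
  have hS0 : 0 ≤ S := mul_nonneg (by positivity) (Finset.sum_nonneg fun i _ => sq_nonneg _)
  -- The drift of `x` is paid by the step-length surplus. As `b ≤ n`, `1 + 1/β ≤ 5n/b`, which
  -- produces the `30` in `hcond`.
  have hc1 : c * (1 + 1 / β) ≤ 1 / (2 * η) - L / 2 := by
    have h1 : c * (1 + 1 / β) ≤ c * (5 * n / b) := by
      gcongr
      rw [hβ, one_div_div, le_div_iff₀ hb', add_mul, div_mul_cancel₀ _ hb'.ne']
      linarith
    have h2 : c * (5 * n / b) = (1 / (2 * η)) * (30 * (η * L) ^ 2 * (n : ℝ) ^ 2 / (b : ℝ) ^ 3) := by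
      rw [hc]; field_simp; ring
    have h3 : 1 / (2 * η) - L / 2 = (1 / (2 * η)) * (1 - η * L) := by field_simp
    rw [h3]
    refine h1.trans (h2.le.trans ?_)
    gcongr
    linarith
  have hstep (I : Fin b → Fin n) : (s.step f ψ μ η I u).lyapunov f ψ Fmin c ≤
      (objective f ψ s.x - Fmin - η / 2 * ‖gradMap η f ψ s.x‖ ^ 2) +
      (η / 2 * ‖gradient (avgLoss f) s.x - s.v f μ I u‖ ^ 2 +
      c * (1 + β) * (1 / (n : ℝ)) * ∑ i, r i *
          if i ∈ Finset.univ.image I then (0 : ℝ) else 1) := by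
    have h1 := objective_prox_step_le H hη s.x (s.v f μ I u)
    have h2 := mul_le_mul_of_nonneg_left
      (sum_norm_step_sub_sq_le (f := f) (ψ := ψ) (μ := μ) (η := η) hβ0 hn s I u) hc0
    have h3 := mul_le_mul_of_nonneg_right hc1
      (sq_nonneg ‖prox η ψ (s.x - η • s.v f μ I u) - s.x‖)
    rw [State.lyapunov]
    change objective f ψ (prox η ψ (s.x - η • s.v f μ I u)) - Fmin + _ ≤ _
    linarith
  have h4 := indexAvg_mono hstep
  rw [indexAvg_add, indexAvg_const hn, indexAvg_add, indexAvg_const_mul, indexAvg_const_mul,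
    indexAvg_sum] at h4
  simp_rw [indexAvg_const_mul, indexAvg_notMem hn] at h4
  rw [← Finset.sum_mul] at h4
  have h5 := mul_le_mul_of_nonneg_left (H.indexAvg_norm_v_sub_gradient_sq_le hn hb hs u)
    (show 0 ≤ η / 2 by positivity)
  have h6 : (1 + β) * (1 - 1 / (n : ℝ)) ^ b ≤ 1 - β := by
    have h7 := one_sub_inv_pow_le hbn hn
    have h8 : (b : ℝ) / (2 * n) = 2 * β := by rw [hβ]; field_simp; norm_num
    rw [h8] at h7
    nlinarith
  have h7 : c * ((1 + β) * (1 - 1 / (n : ℝ)) ^ b) * S ≤ c * (1 - β) * S := by gcongr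
  -- This identity determines `c`: the contraction gain equals the variance due to the reference
  -- points.
  have h8 : c * β = η / 2 * (3 * L ^ 2 / (2 * b)) := by
    rw [hc, hβ]; field_simp; norm_num
  have h9 : c * (1 - β) * S = c * S - η / 2 * (3 * L ^ 2 / (2 * b)) * S := by
    rw [← h8]; ring
  rw [State.lyapunov]
  linarith

end OneStep

/-! ### Measurability of the iteration. -/

section Measurability

variable {d n b : ℕ} {f : Fin n → E d → ℝ} {ψ : E d → ℝ} {L σ η μ : ℝ}

instance : MeasurableSpace (State d n) :=
  MeasurableSpace.comap (fun s => (s.x, s.z, s.w, s.φ)) inferInstance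

lemma State.measurable_components :
    Measurable fun s : State d n => (s.x, s.z, s.w, s.φ) := comap_measurable _

@[fun_prop]
lemma State.measurable_x : Measurable fun s : State d n => s.x :=
  measurable_fst.comp State.measurable_components

@[fun_prop]
lemma State.measurable_z : Measurable fun s : State d n => s.z :=
  (measurable_fst.comp measurable_snd).comp State.measurable_components

@[fun_prop]
lemma State.measurable_w : Measurable fun s : State d n => s.w :=
  (measurable_fst.comp (measurable_snd.comp measurable_snd)).comp State.measurable_components

@[fun_prop]
lemma State.measurable_φ : Measurable fun s : State d n => s.φ :=
  (measurable_snd.comp (measurable_snd.comp measurable_snd)).comp State.measurable_components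

lemma State.measurable_of_components {α : Type*} [MeasurableSpace α] {S : α → State d n}
    (hx : Measurable fun a => (S a).x) (hz : Measurable fun a => (S a).z)
    (hw : Measurable fun a => (S a).w) (hφ : Measurable fun a => (S a).φ) : Measurable S :=
  measurable_comap_iff.2 (hx.prodMk (hz.prodMk (hw.prodMk hφ)))

lemma measurable_gauSGE {h : E d → ℝ} (hh : Continuous h) {α : Type*} [MeasurableSpace α]
    {x u : α → E d} (hx : Measurable x) (hu : Measurable u) :
    Measurable fun a => gauSGE μ h (x a) (u a) := by
  have hm := hh.measurable
  unfold gauSGE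
  exact (((hm.comp (hx.add (hu.const_smul μ))).sub (hm.comp hx)).div_const μ).smul hu

lemma Assumptions.measurable_step_of_batch (H : Assumptions f ψ L σ) (hη : 0 < η)
    (J : Fin b → Fin n) :
    Measurable fun p : (Fin n → E d) × State d n => p.2.step f ψ μ η J p.1 := by
  have hf (i : Fin n) : Continuous (f i) := (H.differentiable i).continuous
  have hp : Measurable (prox η ψ) := (lipschitzWith_prox H.convex hη).continuous.measurable
  have hu' (i : Fin n) : Measurable fun p : (Fin n → E d) × State d n => p.1 i := by fun_prop
  have hz' (i : Fin n) : Measurable fun p : (Fin n → E d) × State d n => p.2.z i := by fun_prop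
  have hw' (i : Fin n) : Measurable fun p : (Fin n → E d) × State d n => p.2.w i := by fun_prop
  have hx' : Measurable fun p : (Fin n → E d) × State d n => p.2.x := by fun_prop
  have hφ' : Measurable fun p : (Fin n → E d) × State d n => p.2.φ := by fun_prop
  have hg (i : Fin n) := measurable_gauSGE (μ := μ) (hf i) hx' (hu' i)
  have hh (i : Fin n) := measurable_gauSGE (μ := μ) (hf i) (hz' i) (hw' i)
  have hv : Measurable fun p : (Fin n → E d) × State d n => p.2.v f μ J p.1 := by
    unfold State.v
    exact ((Finset.measurable_fun_sum _ fun k _ => (hg (J k)).fun_sub (hh (J k))).fun_const_smul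
      (1 / (b : ℝ))).fun_add hφ'
  have hφ'' : Measurable fun p : (Fin n → E d) × State d n => (1 / (n : ℝ)) •
      ∑ i ∈ Finset.univ.image J, (gauSGE μ (f i) (p.2.z i) (p.2.w i) -
        gauSGE μ (f i) p.2.x (p.1 i)) :=
    (Finset.measurable_fun_sum _ fun i _ => (hh i).fun_sub (hg i)).fun_const_smul (1 / (n : ℝ))
  refine State.measurable_of_components ?_ ?_ ?_ ?_
  · change Measurable fun p : (Fin n → E d) × State d n =>
      prox η ψ (p.2.x - η • p.2.v f μ J p.1)
    exact hp.comp (hx'.sub (hv.const_smul η))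
  · refine measurable_pi_lambda _ fun i => ?_
    by_cases hi : i ∈ Finset.univ.image J
    · simpa only [State.step, if_pos hi] using hx'
    · simpa only [State.step, if_neg hi] using hz' i
  · refine measurable_pi_lambda _ fun i => ?_
    by_cases hi : i ∈ Finset.univ.image J
    · simpa only [State.step, if_pos hi] using hu' i
    · simpa only [State.step, if_neg hi] using hw' i
  · exact hφ'.sub hφ''

lemma measurable_comp_of_countable {α β γ δ : Type*} [MeasurableSpace α] [MeasurableSpace β]
    [MeasurableSpace γ] [MeasurableSpace δ] [Countable β] [MeasurableSingletonClass β]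
    {F : β → γ → δ} (hF : ∀ y, Measurable (F y)) {A : α → β} {G : α → γ} (hA : Measurable A)
    (hG : Measurable G) : Measurable fun a => F (A a) (G a) :=
  (measurable_from_prod_countable_right (f := fun p : β × γ => F p.1 p.2) hF).comp (hA.prodMk hG)

lemma Assumptions.measurable_step (H : Assumptions f ψ L σ) (hη : 0 < η) {α : Type*}
    [MeasurableSpace α] {I : α → Fin b → Fin n} {u : α → Fin n → E d} {S : α → State d n}
    (hI : Measurable I) (hu : Measurable u) (hS : Measurable S) :
    Measurable fun a => (S a).step f ψ μ η (I a) (u a) := by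
  have h1 (J : Fin b → Fin n) : Measurable fun p : (Fin n → E d) × State d n =>
    p.2.step f ψ μ η J p.1 := H.measurable_step_of_batch hη J
  have h2 : Measurable fun a => (u a, S a) := hu.prodMk hS
  have h3 := measurable_comp_of_countable h1 hI h2
  dsimp only at h3
  exact h3

/-- The domain is arbitrary and only draws made before `x_t` is used are required measurable, so the
lemma also applies to the σ-algebra generated by the past and thereby yields independence. -/
lemma Assumptions.measurable_run (H : Assumptions f ψ L σ) (hη : 0 < η) {α : Type*}
    [MeasurableSpace α] {I : ℕ → Fin b → α → Fin n} {U : ℕ → Fin n → α → E d} (x₀ : E d) (t : ℕ)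
    (hI : ∀ s < t, ∀ k, Measurable (I s k)) (hU : ∀ s ≤ t, ∀ i, Measurable (U s i)) :
    Measurable fun a => run f ψ μ η x₀ (fun t k => I t k a) (fun t i => U t i a) t := by
  induction t with
  | zero =>
    have hf (i : Fin n) : Continuous (f i) := (H.differentiable i).continuous
    have hU' := hU 0 le_rfl
    refine State.measurable_of_components measurable_const measurable_const
      (measurable_pi_lambda _ hU') ?_
    exact (Finset.measurable_fun_sum _ fun i _ =>
      measurable_gauSGE (hf i) measurable_const (hU' i)).const_smul (1 / (n : ℝ))
  | succ t ih =>
    exact H.measurable_step hη (measurable_pi_lambda _ (hI t (Nat.lt_succ_self t)))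
      (measurable_pi_lambda _ (hU (t + 1) le_rfl))
      (ih (fun s hs => hI s (hs.trans (Nat.lt_succ_self t)))
        (fun s hs => hU s (hs.trans (Nat.le_succ t))))

lemma Assumptions.measurable_gradient (H : Assumptions f ψ L σ) (i : Fin n) :
    Measurable (gradient (f i)) :=
  (continuous_gradient_of_lipschitz (H.lipschitz i)).measurable

lemma Assumptions.measurable_gradMap (H : Assumptions f ψ L σ) (hη : 0 < η) :
    Measurable (gradMap η f ψ) := by
  have h1 : Continuous (prox η ψ) := (lipschitzWith_prox H.convex hη).continuous
  have h2 := continuous_gradient_of_lipschitz H.lipschitz_avgLoss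
  have : Continuous (gradMap η f ψ) := by
    unfold gradMap
    fun_prop
  exact this.measurable

lemma Assumptions.measurable_tableErr (H : Assumptions f ψ L σ) :
    Measurable fun s : State d n => s.tableErr f μ := by
  unfold State.tableErr
  refine (Finset.measurable_fun_sum _ fun i _ => Measurable.pow_const (Measurable.norm ?_) 2).const_mul _
  exact (measurable_gauSGE (H.differentiable i).continuous (by fun_prop) (by fun_prop)).sub
    ((H.measurable_gradient i).comp (by fun_prop))

lemma Assumptions.measurable_lyapunov (H : Assumptions f ψ L σ) (Fmin c : ℝ) :
    Measurable fun s : State d n => s.lyapunov f ψ Fmin c := by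
  have h1 : Measurable (objective f ψ) := by
    have hψ : Continuous ψ := by
      rw [← continuousOn_univ]
      exact H.convex.continuousOn isOpen_univ
    exact (H.differentiable_avgLoss.continuous.add hψ).measurable
  unfold State.lyapunov
  fun_prop

end Measurability

/-! ### Independence of fresh draws from the past. -/

section Independence

variable {Ω : Type*} [MeasurableSpace Ω] {P : Measure Ω}

/-- All three laws factor, and products of measures are associative. -/
lemma indepFun_prodMk_right_of_indepFun_prodMk_left [IsProbabilityMeasure P] {α β γ : Type*} [MeasurableSpace α]
    [MeasurableSpace β] [MeasurableSpace γ] {A : Ω → α} {B : Ω → β} {C : Ω → γ}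
    (hA : Measurable A) (hB : Measurable B) (hC : Measurable C) (hAB : IndepFun A B P)
    (hABC : IndepFun (fun ω => (A ω, B ω)) C P) : IndepFun A (fun ω => (B ω, C ω)) P := by
  have hBC : IndepFun B C P := hABC.comp measurable_snd measurable_id
  have := Measure.isProbabilityMeasure_map hA.aemeasurable (μ := P)
  have := Measure.isProbabilityMeasure_map hB.aemeasurable (μ := P)
  have := Measure.isProbabilityMeasure_map hC.aemeasurable (μ := P)
  rw [indepFun_iff_map_prod_eq_prod_map_map hA.aemeasurable (hB.prodMk hC).aemeasurable,
    (indepFun_iff_map_prod_eq_prod_map_map hB.aemeasurable hC.aemeasurable).1 hBC,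
    ← Measure.prodAssoc_prod,
    ← (indepFun_iff_map_prod_eq_prod_map_map hA.aemeasurable hB.aemeasurable).1 hAB,
    ← (indepFun_iff_map_prod_eq_prod_map_map (hA.prodMk hB).aemeasurable hC.aemeasurable).1 hABC,
    Measure.map_map (MeasurableEquiv.measurable _) (by fun_prop)]
  rfl

lemma IndepFun.of_measurable_comap_right {α β γ : Type*} [MeasurableSpace α]
    [MeasurableSpace β] [MeasurableSpace γ] {A : Ω → α} {B : Ω → β} {C : Ω → γ}
    (h : IndepFun A B P) (hC : Measurable[MeasurableSpace.comap B inferInstance] C) :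
    IndepFun A C P := by
  rw [IndepFun_iff_Indep] at h ⊢
  exact indep_of_indep_of_le_right h hC.comap_le

lemma lintegral_comp_prodMk_of_indepFun [IsProbabilityMeasure P] {α β : Type*} [MeasurableSpace α]
    [MeasurableSpace β] {A : Ω → α} {B : Ω → β} (hA : Measurable A) (hB : Measurable B)
    (h : IndepFun A B P) {G : α × β → ENNReal} (hG : Measurable G) :
    ∫⁻ ω, G (A ω, B ω) ∂P = ∫⁻ ω, ∫⁻ a, G (a, B ω) ∂(P.map A) ∂P := by
  have := Measure.isProbabilityMeasure_map hA.aemeasurable (μ := P)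
  have := Measure.isProbabilityMeasure_map hB.aemeasurable (μ := P)
  rw [← lintegral_map hG (hA.prodMk hB),
    (indepFun_iff_map_prod_eq_prod_map_map hA.aemeasurable hB.aemeasurable).1 h,
    lintegral_prod_symm' _ hG, lintegral_map hG.lintegral_prod_left' hB]

variable {d n b : ℕ} {I : ℕ → Fin b → Ω → Fin n} {U : ℕ → Fin n → Ω → E d}
  {f : Fin n → E d → ℝ} {ψ : E d → ℝ} {L σ η μ : ℝ}

/-- The mini-batch of an iteration is independent of the earlier mini-batches and all directions. -/
lemma Sampling.indepFun_batch [IsProbabilityMeasure P] (hS : Sampling P I U) (t : ℕ) :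
    IndepFun (fun ω k => I t k ω)
      (fun ω => ((fun q : (Finset.range t ×ˢ (Finset.univ : Finset (Fin b)) : Finset _) =>
        I q.1.1 q.1.2 ω), (fun q : ℕ × Fin n => U q.1 q.2 ω))) P := by
  have hI := hS.measurable_index
  have hU := hS.measurable_direction
  refine indepFun_prodMk_right_of_indepFun_prodMk_left (measurable_pi_lambda _ (hI t))
    (measurable_pi_lambda _ fun q => hI _ _) (measurable_pi_lambda _ fun q => hU _ _) ?_ ?_
  · have h := hS.indep_index.indepFun_finset ({t} ×ˢ (Finset.univ : Finset (Fin b)))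
      (Finset.range t ×ˢ (Finset.univ : Finset (Fin b)))
      (by
        rw [Finset.disjoint_product]
        left
        simp)
      (fun q => hI _ _)
    exact h.comp (φ := fun g k => g ⟨(t, k), by simp⟩)
      (measurable_pi_lambda _ fun k => measurable_pi_apply _) measurable_id
  · exact hS.indep.comp (φ := fun g => ((fun k => g (t, k)),
      (fun q : (Finset.range t ×ˢ (Finset.univ : Finset (Fin b)) : Finset _) => g q.1)))
      (by fun_prop) measurable_id

/-- The directions of an iteration are independent of the earlier directions and all
mini-batches. -/
lemma Sampling.indepFun_direction [IsProbabilityMeasure P] (hS : Sampling P I U) (t : ℕ) (i : Fin n) :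
    IndepFun (U (t + 1) i)
      (fun ω => ((fun q : (Finset.range (t + 1) ×ˢ (Finset.univ : Finset (Fin n)) : Finset _) =>
        U q.1.1 q.1.2 ω), (fun q : ℕ × Fin b => I q.1 q.2 ω))) P := by
  have hI := hS.measurable_index
  have hU := hS.measurable_direction
  refine indepFun_prodMk_right_of_indepFun_prodMk_left (hU _ _)
    (measurable_pi_lambda _ fun q => hU _ _) (measurable_pi_lambda _ fun q => hI _ _) ?_ ?_
  · have h := hS.indep_direction.indepFun_finset ({t + 1} ×ˢ (Finset.univ : Finset (Fin n)))
      (Finset.range (t + 1) ×ˢ (Finset.univ : Finset (Fin n)))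
      (by
        rw [Finset.disjoint_product]
        left
        simp)
      (fun q => hU _ _)
    exact h.comp (φ := fun g : (({t + 1} ×ˢ Finset.univ : Finset (ℕ × Fin n)) → E d) =>
      g ⟨(t + 1, i), by simp⟩) (measurable_pi_apply _) measurable_id
  · exact hS.indep.symm.comp (φ := fun g => (g (t + 1, i),
      (fun q : (Finset.range (t + 1) ×ˢ (Finset.univ : Finset (Fin n)) : Finset _) => g q.1)))
      (by fun_prop) measurable_id

lemma Sampling.measurable_run (hS : Sampling P I U) (H : Assumptions f ψ L σ) (hη : 0 < η)
    (x₀ : E d) (t : ℕ) :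
    Measurable fun ω => run f ψ μ η x₀ (fun t k => I t k ω) (fun t i => U t i ω) t :=
  H.measurable_run hη x₀ t (fun s _ k => hS.measurable_index s k)
    (fun s _ i => hS.measurable_direction s i)

lemma Sampling.indepFun_batch_run [IsProbabilityMeasure P] (hS : Sampling P I U) (H : Assumptions f ψ L σ) (hη : 0 < η)
    (x₀ : E d) (t : ℕ) :
    IndepFun (fun ω k => I t k ω)
      (fun ω => ((fun i => U (t + 1) i ω),
        run f ψ μ η x₀ (fun t k => I t k ω) (fun t i => U t i ω) t)) P := by
  refine IndepFun.of_measurable_comap_right (hS.indepFun_batch t) ?_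
  set B := fun ω => ((fun q : (Finset.range t ×ˢ (Finset.univ : Finset (Fin b)) : Finset _) =>
        I q.1.1 q.1.2 ω), (fun q : ℕ × Fin n => U q.1 q.2 ω)) with hB
  -- `Ω` now carries the σ-algebra generated by `B`, so measurability of the run means that it is a
  -- function of `B`.
  let _ : MeasurableSpace Ω := MeasurableSpace.comap B inferInstance
  have hBm : Measurable B := comap_measurable B
  have hI : ∀ s < t, ∀ k, Measurable (I s k) := fun s hs k =>
    (measurable_pi_apply (⟨(s, k), by simp [hs]⟩ :
      (Finset.range t ×ˢ (Finset.univ : Finset (Fin b)) : Finset _))).comp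
      (measurable_fst.comp hBm)
  have hU : ∀ s i, Measurable (U s i) := fun s i =>
    (measurable_pi_apply (s, i)).comp (measurable_snd.comp hBm)
  exact (measurable_pi_lambda _ (hU (t + 1))).prodMk
    (H.measurable_run hη x₀ t hI fun s _ => hU s)

lemma Sampling.indepFun_direction_run [IsProbabilityMeasure P] (hS : Sampling P I U) (H : Assumptions f ψ L σ)
    (hη : 0 < η) (x₀ : E d) (t : ℕ) (i : Fin n) :
    IndepFun (U (t + 1) i)
      (fun ω => run f ψ μ η x₀ (fun t k => I t k ω) (fun t i => U t i ω) t) P := by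
  refine IndepFun.of_measurable_comap_right (hS.indepFun_direction t i) ?_
  set B := fun ω => ((fun q : (Finset.range (t + 1) ×ˢ (Finset.univ : Finset (Fin n)) : Finset _) =>
        U q.1.1 q.1.2 ω), (fun q : ℕ × Fin b => I q.1 q.2 ω)) with hB
  let _ : MeasurableSpace Ω := MeasurableSpace.comap B inferInstance
  have hBm : Measurable B := comap_measurable B
  have hU : ∀ s ≤ t, ∀ k, Measurable (U s k) := fun s hs k =>
    (measurable_pi_apply (⟨(s, k), by simp; omega⟩ :
      (Finset.range (t + 1) ×ˢ (Finset.univ : Finset (Fin n)) : Finset _))).comp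
      (measurable_fst.comp hBm)
  have hI : ∀ s k, Measurable (I s k) := fun s k =>
    (measurable_pi_apply (s, k)).comp (measurable_snd.comp hBm)
  exact H.measurable_run hη x₀ t (fun s _ => hI s) hU

lemma Sampling.map_batch_singleton [IsProbabilityMeasure P] (hS : Sampling P I U) (t : ℕ) (J : Fin b → Fin n) :
    P.map (fun ω k => I t k ω) {J} = ((n : ENNReal) ^ b)⁻¹ := by
  have h := hS.indep_index.precomp (g := fun k => (t, k)) (fun k k' h => (Prod.ext_iff.1 h).2)
  rw [iIndepFun.map_fun_eq_pi_map (fun k => (hS.measurable_index t k).aemeasurable) h,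
    Measure.pi_singleton]
  simp only [hS.law_index, uniformOn_univ]
  simp [ENNReal.inv_pow]

/-- Averaging out a mini-batch that is independent of everything else. -/
lemma Sampling.lintegral_batch [IsProbabilityMeasure P] (hS : Sampling P I U) (t : ℕ) {γ : Type*} [MeasurableSpace γ]
    {G : Ω → γ} (hG : Measurable G) (hn : 0 < n) (hind : IndepFun (fun ω k => I t k ω) G P)
    {K : (Fin b → Fin n) → γ → ℝ} (hK : ∀ J, Measurable (K J)) (hK0 : ∀ J y, 0 ≤ K J y) :
    ∫⁻ ω, ENNReal.ofReal (K (fun k => I t k ω) (G ω)) ∂P =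
      ∫⁻ ω, ENNReal.ofReal (indexAvg fun J => K J (G ω)) ∂P := by
  have hA : Measurable (fun ω k => I t k ω) := measurable_pi_lambda _ (hS.measurable_index t)
  have hKm : Measurable fun p : (Fin b → Fin n) × γ => ENNReal.ofReal (K p.1 p.2) :=
    (measurable_from_prod_countable_right fun J => hK J).ennreal_ofReal
  rw [lintegral_comp_prodMk_of_indepFun hA hG hind hKm]
  refine lintegral_congr fun ω => ?_
  rw [lintegral_fintype]
  simp only [hS.map_batch_singleton]
  rw [← Finset.sum_mul, ← ENNReal.ofReal_sum_of_nonneg (fun J _ => hK0 J _), indexAvg, mul_comm,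
    ENNReal.ofReal_mul (by positivity), ENNReal.ofReal_inv_of_pos (by positivity),
    ENNReal.ofReal_pow (by positivity), ENNReal.ofReal_natCast]

end Independence

/-! ### Expected errors and the telescoped Lyapunov bound. -/

section Expectation

variable {Ω : Type*} [MeasurableSpace Ω] {P : Measure Ω} [IsProbabilityMeasure P]
variable {d n b : ℕ} {I : ℕ → Fin b → Ω → Fin n} {U : ℕ → Fin n → Ω → E d}
  {f : Fin n → E d → ℝ} {ψ : E d → ℝ} {L σ η μ : ℝ}

/-- A bound for the second moment of the error of a Gaussian smoothing gradient estimate. -/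
def gauSGEErr (d : ℕ) (L σ μ : ℝ) : ℝ :=
  (2 * d + 9) * σ ^ 2 + ((d : ℝ) + 6) ^ 3 * L ^ 2 * μ ^ 2 / 2

lemma gauSGEErr_nonneg : 0 ≤ gauSGEErr d L σ μ := by unfold gauSGEErr; positivity

lemma freshErr_nonneg (x : E d) (u : Fin n → E d) : 0 ≤ freshErr f μ x u := by
  unfold freshErr; positivity

lemma State.tableErr_nonneg (s : State d n) : 0 ≤ s.tableErr f μ := by
  unfold State.tableErr; positivity

lemma State.lyapunov_nonneg {Fmin c : ℝ} (hF : ∀ x, Fmin ≤ objective f ψ x) (hc : 0 ≤ c)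
    (s : State d n) : 0 ≤ s.lyapunov f ψ Fmin c := by
  unfold State.lyapunov
  have := hF s.x
  have h2 : 0 ≤ c * (1 / (n : ℝ) * ∑ i, ‖s.x - s.z i‖ ^ 2) := by positivity
  linarith

/-- Independence lets each direction be integrated out at a frozen point, where the Gaussian bound
is uniform. The error is a sum over `i`, so independence of each single direction from `X` is
enough. -/
lemma Assumptions.lintegral_freshErr_le (H : Assumptions f ψ L σ) (hn : 0 < n) (hμ : 0 < μ)
    {X : Ω → E d} {W : Fin n → Ω → E d} (hX : Measurable X) (hW : ∀ i, Measurable (W i))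
    (hlaw : ∀ i, P.map (W i) = stdGaussian (E d)) (hind : ∀ i, IndepFun (W i) X P) :
    ∫⁻ ω, ENNReal.ofReal (freshErr f μ (X ω) (fun i => W i ω)) ∂P ≤
      ENNReal.ofReal (gauSGEErr d L σ μ) := by
  have hm (i : Fin n) : Measurable fun p : E d × E d =>
      ENNReal.ofReal (‖gauSGE μ (f i) p.2 p.1 - gradient (f i) p.2‖ ^ 2) := by
    refine (Measurable.pow_const (Measurable.norm ?_) 2).ennreal_ofReal
    exact (measurable_gauSGE (H.differentiable i).continuous measurable_snd measurable_fst).sub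
      ((H.measurable_gradient i).comp measurable_snd)
  have h1 (i : Fin n) : ∫⁻ ω, ENNReal.ofReal
      (‖gauSGE μ (f i) (X ω) (W i ω) - gradient (f i) (X ω)‖ ^ 2) ∂P ≤
      ENNReal.ofReal (gauSGEErr d L σ μ) := by
    have h := lintegral_comp_prodMk_of_indepFun (hW i) hX (hind i) (hm i)
    dsimp only at h
    rw [h, hlaw]
    calc _ ≤ ∫⁻ _, ENNReal.ofReal (gauSGEErr d L σ μ) ∂P := by
          gcongr with ω
          exact lintegral_gauSGE_sub_gradient_le hμ (H.differentiable i) (H.lipschitz i)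
            (H.bounded i) (X ω)
      _ = _ := by simp
  have hn' : (n : ℝ) ≠ 0 := by positivity
  unfold freshErr
  simp_rw [ENNReal.ofReal_mul (show 0 ≤ 1 / (n : ℝ) by positivity),
    ENNReal.ofReal_sum_of_nonneg (fun i (_ : i ∈ Finset.univ) => sq_nonneg _)]
  rw [lintegral_const_mul' _ _ ENNReal.ofReal_ne_top, lintegral_finsetSum]
  · calc _ ≤ ENNReal.ofReal (1 / n) * ∑ _i : Fin n, ENNReal.ofReal (gauSGEErr d L σ μ) := by
          gcongr with i
          exact h1 i
      _ = _ := by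
          rw [← ENNReal.ofReal_sum_of_nonneg (fun _ _ => gauSGEErr_nonneg),
            ← ENNReal.ofReal_mul (by positivity)]
          congr 1
          simp [hn']
  · intro i _
    have := (hm i).comp ((hW i).prodMk hX)
    simpa only [Function.comp_def] using this

variable (H : Assumptions f ψ L σ) (hS : Sampling P I U) (x₀ : E d)
include H hS

lemma lintegral_freshErr_run_le (hn : 0 < n) (hη : 0 < η) (hμ : 0 < μ) (t : ℕ) :
    ∫⁻ ω, ENNReal.ofReal (freshErr f μ
      (run f ψ μ η x₀ (fun t k => I t k ω) (fun t i => U t i ω) t).x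
      (fun i => U (t + 1) i ω)) ∂P ≤ ENNReal.ofReal (gauSGEErr d L σ μ) :=
  H.lintegral_freshErr_le hn hμ (State.measurable_x.comp (hS.measurable_run H hη x₀ t))
    (hS.measurable_direction (t + 1)) (hS.law_direction (t + 1)) fun i =>
      (hS.indepFun_direction_run H hη x₀ t i).comp measurable_id State.measurable_x

lemma lintegral_tableErr_run_le (hn : 0 < n) (hη : 0 < η) (hμ : 0 < μ) (t : ℕ) :
    ∫⁻ ω, ENNReal.ofReal
      ((run f ψ μ η x₀ (fun t k => I t k ω) (fun t i => U t i ω) t).tableErr f μ) ∂P ≤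
      ENNReal.ofReal (gauSGEErr d L σ μ) := by
  induction t with
  | zero =>
    -- The initial table consists of fresh estimates at the constant point `x₀`.
    exact H.lintegral_freshErr_le hn hμ (X := fun _ => x₀) measurable_const
      (hS.measurable_direction 0) (hS.law_direction 0) fun i => indepFun_const_right _ _
  | succ t ih =>
    set S := fun ω => run f ψ μ η x₀ (fun t k => I t k ω) (fun t i => U t i ω) t with hSdef
    have hSm : Measurable S := hS.measurable_run H hη x₀ t
    have hUm : Measurable fun ω i => U (t + 1) i ω :=
      measurable_pi_lambda _ (hS.measurable_direction (t + 1))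
    set κ := (1 - 1 / (n : ℝ)) ^ b with hκ
    have hn1 : (1 : ℝ) ≤ n := by exact_mod_cast hn
    have hn2 : 1 / (n : ℝ) ≤ 1 := by rw [div_le_one (by linarith)]; exact hn1
    have hn3 : 0 ≤ 1 / (n : ℝ) := by positivity
    have hκ0 : 0 ≤ κ := pow_nonneg (by linarith) _
    have hκ1 : 0 ≤ 1 - κ := sub_nonneg.2 (pow_le_one₀ (by linarith) (by linarith))
    have h1 := hS.lintegral_batch t (hUm.prodMk hSm) hn (hS.indepFun_batch_run H hη x₀ t)
      (K := fun J (p : (Fin n → E d) × State d n) => (p.2.step f ψ μ η J p.1).tableErr f μ)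
      (fun J => H.measurable_tableErr.comp (H.measurable_step_of_batch hη J))
      (fun J p => State.tableErr_nonneg _)
    dsimp only at h1
    change ∫⁻ ω, ENNReal.ofReal (((S ω).step f ψ μ η (fun k => I t k ω)
      (fun i => U (t + 1) i ω)).tableErr f μ) ∂P ≤ _
    rw [h1]
    simp_rw [indexAvg_tableErr_step hn, ← hκ]
    simp_rw [fun ω => ENNReal.ofReal_add (mul_nonneg hκ0 ((S ω).tableErr_nonneg (f := f) (μ := μ)))
      (mul_nonneg hκ1 (freshErr_nonneg (f := f) (μ := μ) (S ω).x (fun i => U (t + 1) i ω))),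
      ENNReal.ofReal_mul hκ0, ENNReal.ofReal_mul hκ1]
    have htm : Measurable fun ω => ENNReal.ofReal ((S ω).tableErr f μ) :=
      (H.measurable_tableErr.comp hSm).ennreal_ofReal
    rw [lintegral_add_left (htm.const_mul _),
      lintegral_const_mul' _ _ ENNReal.ofReal_ne_top, lintegral_const_mul' _ _ ENNReal.ofReal_ne_top]
    calc _ ≤ ENNReal.ofReal κ * ENNReal.ofReal (gauSGEErr d L σ μ) +
          ENNReal.ofReal (1 - κ) * ENNReal.ofReal (gauSGEErr d L σ μ) := by
          gcongr
          exact lintegral_freshErr_run_le H hS x₀ hn hη hμ t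
      _ = _ := by
          rw [← add_mul, ← ENNReal.ofReal_add hκ0 hκ1]
          simp

/-- The expected decrease of the Lyapunov function in one iteration. -/
lemma lintegral_lyapunov_run_succ_le (hb : 0 < b) (hbn : b ≤ n)
    (hη : 0 < η) (hμ : 0 < μ)
    (hcond : 30 * (η * L) ^ 2 * (n : ℝ) ^ 2 / (b : ℝ) ^ 3 + η * L ≤ 1) {c : ℝ}
    (hc : c = 3 * η * L ^ 2 * n / (b : ℝ) ^ 2) {Fmin : ℝ} (hF : ∀ x, Fmin ≤ objective f ψ x)
    (t : ℕ) :
    ∫⁻ ω, ENNReal.ofReal ((run f ψ μ η x₀ (fun t k => I t k ω) (fun t i => U t i ω)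
        (t + 1)).lyapunov f ψ Fmin c) ∂P +
      ENNReal.ofReal (η / 2) *
        ∫⁻ ω, ENNReal.ofReal (‖gradMap η f ψ (iterate f ψ μ η x₀ I U t ω)‖ ^ 2) ∂P ≤
    ∫⁻ ω, ENNReal.ofReal ((run f ψ μ η x₀ (fun t k => I t k ω) (fun t i => U t i ω)
        t).lyapunov f ψ Fmin c) ∂P +
      ENNReal.ofReal (η / 2 * ((1 + 12 / b) * gauSGEErr d L σ μ)) := by
  have hn : 0 < n := hb.trans_le hbn
  have hL := H.L_pos
  have hc0 : 0 ≤ c := by rw [hc]; positivity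
  set S := fun ω => run f ψ μ η x₀ (fun t k => I t k ω) (fun t i => U t i ω) t with hSdef
  have hSm : Measurable S := hS.measurable_run H hη x₀ t
  have hUm : Measurable fun ω i => U (t + 1) i ω :=
    measurable_pi_lambda _ (hS.measurable_direction (t + 1))
  have h1 := hS.lintegral_batch t (hUm.prodMk hSm) hn (hS.indepFun_batch_run H hη x₀ t)
    (K := fun J (p : (Fin n → E d) × State d n) => (p.2.step f ψ μ η J p.1).lyapunov f ψ Fmin c)
    (fun J => (H.measurable_lyapunov Fmin c).comp (H.measurable_step_of_batch hη J))
    (fun J p => State.lyapunov_nonneg hF hc0 _)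
  dsimp only at h1
  change ∫⁻ ω, ENNReal.ofReal (((S ω).step f ψ μ η (fun k => I t k ω)
    (fun i => U (t + 1) i ω)).lyapunov f ψ Fmin c) ∂P + ENNReal.ofReal (η / 2) *
      ∫⁻ ω, ENNReal.ofReal (‖gradMap η f ψ (S ω).x‖ ^ 2) ∂P ≤ _
  rw [h1]
  have hgm : Measurable fun ω => ENNReal.ofReal (‖gradMap η f ψ (S ω).x‖ ^ 2) :=
    (((H.measurable_gradMap hη).comp (State.measurable_x.comp hSm)).norm.pow_const 2).ennreal_ofReal
  have hη2 : 0 ≤ η / 2 := by positivity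
  rw [← lintegral_const_mul' _ _ ENNReal.ofReal_ne_top, ← lintegral_add_right _ (hgm.const_mul _)]
  have hA : 0 ≤ η / 2 * (1 + 6 / b) := by positivity
  have hB : 0 ≤ η / 2 * (6 / b) := by positivity
  calc _ ≤ ∫⁻ ω, (ENNReal.ofReal ((S ω).lyapunov f ψ Fmin c) +
        (ENNReal.ofReal (η / 2 * (1 + 6 / b)) *
          ENNReal.ofReal (freshErr f μ (S ω).x (fun i => U (t + 1) i ω)) +
        ENNReal.ofReal (η / 2 * (6 / b)) * ENNReal.ofReal ((S ω).tableErr f μ))) ∂P := by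
        refine lintegral_mono fun ω => ?_
        have hcons : (S ω).Consistent f μ := run_consistent x₀ _ _ t
        have h2 := H.indexAvg_lyapunov_step_le hb hbn hη hcond hc Fmin hcons
          (fun i => U (t + 1) i ω)
        have ha := freshErr_nonneg (f := f) (μ := μ) (S ω).x (fun i => U (t + 1) i ω)
        have hb := (S ω).tableErr_nonneg (f := f) (μ := μ)
        have hl := State.lyapunov_nonneg hF hc0 (S ω)
        have hi : 0 ≤ indexAvg (fun J : Fin b → Fin n => ((S ω).step f ψ μ η J
            (fun i => U (t + 1) i ω)).lyapunov f ψ Fmin c) :=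
          mul_nonneg (by positivity)
            (Finset.sum_nonneg fun J _ => State.lyapunov_nonneg hF hc0 _)
        dsimp only
        rw [← ENNReal.ofReal_mul hη2, ← ENNReal.ofReal_mul hA, ← ENNReal.ofReal_mul hB,
          ← ENNReal.ofReal_add hi (by positivity),
          ← ENNReal.ofReal_add (mul_nonneg hA ha) (mul_nonneg hB hb),
          ← ENNReal.ofReal_add hl (add_nonneg (mul_nonneg hA ha) (mul_nonneg hB hb))]
        apply ENNReal.ofReal_le_ofReal
        linarith
    _ = ∫⁻ ω, ENNReal.ofReal ((S ω).lyapunov f ψ Fmin c) ∂P +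
        (ENNReal.ofReal (η / 2 * (1 + 6 / b)) *
          ∫⁻ ω, ENNReal.ofReal (freshErr f μ (S ω).x (fun i => U (t + 1) i ω)) ∂P +
        ENNReal.ofReal (η / 2 * (6 / b)) * ∫⁻ ω, ENNReal.ofReal ((S ω).tableErr f μ) ∂P) := by
        have htm : Measurable fun ω => ENNReal.ofReal ((S ω).tableErr f μ) :=
          (H.measurable_tableErr.comp hSm).ennreal_ofReal
        have hlm : Measurable fun ω => ENNReal.ofReal ((S ω).lyapunov f ψ Fmin c) :=
          ((H.measurable_lyapunov Fmin c).comp hSm).ennreal_ofReal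
        rw [lintegral_add_left hlm, lintegral_add_right _ (htm.const_mul _),
          lintegral_const_mul' _ _ ENNReal.ofReal_ne_top,
          lintegral_const_mul' _ _ ENNReal.ofReal_ne_top]
    _ ≤ ∫⁻ ω, ENNReal.ofReal ((S ω).lyapunov f ψ Fmin c) ∂P +
        (ENNReal.ofReal (η / 2 * (1 + 6 / b)) * ENNReal.ofReal (gauSGEErr d L σ μ) +
        ENNReal.ofReal (η / 2 * (6 / b)) * ENNReal.ofReal (gauSGEErr d L σ μ)) := by
        gcongr
        · exact lintegral_freshErr_run_le H hS x₀ hn hη hμ t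
        · exact lintegral_tableErr_run_le H hS x₀ hn hη hμ t
    _ = _ := by
        rw [← add_mul, ← ENNReal.ofReal_add hA hB, ← ENNReal.ofReal_mul (add_nonneg hA hB)]
        congr 2
        ring

/-- The expected squared gradient mappings are finite, and their sum is bounded. -/
theorem sum_integral_norm_gradMap_sq_le (hb : 0 < b) (hbn : b ≤ n)
    (hη : 0 < η) (hμ : 0 < μ)
    (hcond : 30 * (η * L) ^ 2 * (n : ℝ) ^ 2 / (b : ℝ) ^ 3 + η * L ≤ 1)
    {Fmin : ℝ} (hF : ∀ x, Fmin ≤ objective f ψ x) :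
    (∀ t, Integrable (fun ω => ‖gradMap η f ψ (iterate f ψ μ η x₀ I U t ω)‖ ^ 2) P) ∧
    ∀ T : ℕ, η / 2 * ∑ t ∈ Finset.Icc 1 T,
        ∫ ω, ‖gradMap η f ψ (iterate f ψ μ η x₀ I U t ω)‖ ^ 2 ∂P ≤
      objective f ψ x₀ - Fmin + (T + 1) * (η / 2 * ((1 + 12 / b) * gauSGEErr d L σ μ)) := by
  have hL := H.L_pos
  obtain ⟨c, hc⟩ : ∃ c, c = 3 * η * L ^ 2 * n / (b : ℝ) ^ 2 := ⟨_, rfl⟩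
  set N := η / 2 * ((1 + 12 / b) * gauSGEErr d L σ μ) with hN
  have hN0 : 0 ≤ N := mul_nonneg (by positivity) (mul_nonneg (by positivity) gauSGEErr_nonneg)
  set g := fun t ω => ‖gradMap η f ψ (iterate f ψ μ η x₀ I U t ω)‖ ^ 2 with hg
  have hg0 (t ω) : 0 ≤ g t ω := sq_nonneg _
  have hgm (t : ℕ) : Measurable (g t) :=
    ((H.measurable_gradMap hη).comp
      (State.measurable_x.comp (hS.measurable_run H hη x₀ t))).norm.pow_const 2
  have htel (m : ℕ) : ∫⁻ ω, ENNReal.ofReal ((run f ψ μ η x₀ (fun t k => I t k ω)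
        (fun t i => U t i ω) m).lyapunov f ψ Fmin c) ∂P +
      ∑ t ∈ Finset.range m, ENNReal.ofReal (η / 2) * ∫⁻ ω, ENNReal.ofReal (g t ω) ∂P ≤
      ENNReal.ofReal (objective f ψ x₀ - Fmin + m * N) := by
    induction m with
    -- Initially all reference points equal `x₀`, so only the suboptimality remains.
    | zero => simp [run, State.init, State.lyapunov]
    | succ m ih =>
      have h1 := lintegral_lyapunov_run_succ_le H hS x₀ hb hbn hη hμ hcond hc hF m
      have hF0 := hF x₀
      rw [Finset.sum_range_succ]
      calc _ = (∫⁻ ω, ENNReal.ofReal ((run f ψ μ η x₀ (fun t k => I t k ω)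
              (fun t i => U t i ω) (m + 1)).lyapunov f ψ Fmin c) ∂P +
              ENNReal.ofReal (η / 2) * ∫⁻ ω, ENNReal.ofReal (g m ω) ∂P) +
              ∑ t ∈ Finset.range m, ENNReal.ofReal (η / 2) * ∫⁻ ω, ENNReal.ofReal (g t ω) ∂P := by
            ring
        _ ≤ _ := add_le_add_left h1 _
        _ = _ := add_right_comm _ _ _
        _ ≤ _ := add_le_add_left ih _
        _ = _ := by
            rw [← ENNReal.ofReal_add (add_nonneg (by linarith) (by positivity)) hN0]
            congr 1
            push_cast
            ring
  have hη2 : 0 < η / 2 := by positivity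
  have hint (t : ℕ) : Integrable (g t) P := by
    refine ⟨(hgm t).aestronglyMeasurable, ?_⟩
    rw [hasFiniteIntegral_iff_ofReal (.of_forall (hg0 t))]
    have h1 : ENNReal.ofReal (η / 2) * ∫⁻ ω, ENNReal.ofReal (g t ω) ∂P < ⊤ := by
      refine lt_of_le_of_lt ?_ ((htel (t + 1)).trans_lt ENNReal.ofReal_lt_top)
      rw [Finset.sum_range_succ]
      exact le_add_left (le_add_left le_rfl)
    exact ENNReal.lt_top_of_mul_ne_top_right h1.ne (by simpa using hη)
  refine ⟨hint, fun T => ?_⟩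
  -- `T + 1` iterations cover `t = 0, …, T`; the term `t = 0` is dropped below, which explains the
  -- `T + 1` noise terms.
  have h1 := (le_add_left le_rfl).trans (htel (T + 1))
  simp_rw [← fun t => ofReal_integral_eq_lintegral_ofReal (hint t) (.of_forall (hg0 t)),
    ← ENNReal.ofReal_mul hη2.le] at h1
  have hI0 (t : ℕ) : 0 ≤ η / 2 * ∫ ω, g t ω ∂P := mul_nonneg hη2.le (integral_nonneg (hg0 t))
  rw [← ENNReal.ofReal_sum_of_nonneg (fun t _ => hI0 t), ENNReal.ofReal_le_ofReal_iff
    (add_nonneg (by linarith [hF x₀]) (by positivity)), ← Finset.mul_sum] at h1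
  push_cast at h1
  refine le_trans (mul_le_mul_of_nonneg_left ?_ hη2.le) h1
  refine Finset.sum_le_sum_of_subset_of_nonneg (fun t ht => ?_)
    fun t _ _ => integral_nonneg (hg0 t)
  rw [Finset.mem_Icc] at ht
  exact Finset.mem_range.2 (by omega)

end Expectation

/-! ### Batch-size arithmetic and the passage to the mean. -/

section Rate

lemma sq_le_four_mul_floor_rpow_cube {n : ℕ} (hn : 1 ≤ n) :
    (n : ℝ) ^ 2 ≤ 4 * ((⌊(n : ℝ) ^ (2 / 3 : ℝ)⌋₊ : ℕ) : ℝ) ^ 3 := by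
  have hn' : (1 : ℝ) ≤ n := by exact_mod_cast hn
  set r := (n : ℝ) ^ (2 / 3 : ℝ) with hr
  have hr3 : r ^ 3 = (n : ℝ) ^ 2 := by
    rw [hr, ← Real.rpow_natCast, ← Real.rpow_mul (by positivity), ← Real.rpow_natCast]
    norm_num
  have hr1 : 1 ≤ r := Real.one_le_rpow hn' (by norm_num)
  have hlt := Nat.lt_floor_add_one r
  have hb1 : 1 ≤ ⌊r⌋₊ := (Nat.one_le_floor_iff r).2 hr1
  set b := ⌊r⌋₊
  have h1 : r ^ 3 < ((b : ℝ) + 1) ^ 3 := by gcongr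
  rw [hr3] at h1
  -- For `b = 1` one has `n ≤ 2`, with equality in the claim at `n = 2`; for `b ≥ 2`, `(b + 1)³ ≤
  -- (27/8) b³`.
  rcases hb1.eq_or_lt with hb | hb
  · rw [← hb] at h1 ⊢
    have h2 : n ^ 2 < 8 := by
      have : (n : ℝ) ^ 2 < 8 := by norm_num at h1; linarith
      exact_mod_cast this
    have h3 : n ≤ 2 := by nlinarith
    have h4 : (n : ℝ) ≤ 2 := by exact_mod_cast h3
    norm_num
    nlinarith
  · have hb' : (2 : ℝ) ≤ b := by exact_mod_cast hb
    have h2 : ((b : ℝ) + 1) ^ 3 ≤ (3 / 2 * b) ^ 3 := by gcongr; linarith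
    have h3 : (0 : ℝ) ≤ (b : ℝ) ^ 3 := by positivity
    rw [mul_pow] at h2
    linarith

lemma sq_le_four_mul_cube_of_eq_floor_or_ceil {n b : ℕ} (hn : 1 ≤ n)
    (hb : b = ⌊(n : ℝ) ^ (2 / 3 : ℝ)⌋₊ ∨ b = ⌈(n : ℝ) ^ (2 / 3 : ℝ)⌉₊) :
    1 ≤ b ∧ b ≤ n ∧ (n : ℝ) ^ 2 ≤ 4 * (b : ℝ) ^ 3 := by
  have hn' : (1 : ℝ) ≤ n := by exact_mod_cast hn
  set r := (n : ℝ) ^ (2 / 3 : ℝ) with hr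
  have hr1 : 1 ≤ r := Real.one_le_rpow hn' (by norm_num)
  have hrn : r ≤ n := by
    calc r ≤ (n : ℝ) ^ (1 : ℝ) := Real.rpow_le_rpow_of_exponent_le hn' (by norm_num)
      _ = n := Real.rpow_one _
  have hfl : ⌊r⌋₊ ≤ b := by
    rcases hb with rfl | rfl
    · rfl
    · exact Nat.floor_le_ceil r
  have hce : b ≤ ⌈r⌉₊ := by
    rcases hb with rfl | rfl
    · exact Nat.floor_le_ceil r
    · rfl
  refine ⟨((Nat.one_le_floor_iff r).2 hr1).trans hfl, hce.trans (Nat.ceil_le.2 hrn),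
    (sq_le_four_mul_floor_rpow_cube hn).trans ?_⟩
  have : ((⌊r⌋₊ : ℕ) : ℝ) ≤ b := by exact_mod_cast hfl
  gcongr

/-- Dividing a summed bound by the number of iterations. -/
lemma mean_le_of_sum_le {T : ℕ} {η γ A D N B : ℝ} (hT : 1 ≤ T) (hγ : 0 < γ) (hγη : γ ≤ η / 2)
    (hD : 0 ≤ D) (hN : 0 ≤ N) (hNB : N ≤ B) (h : η / 2 * A ≤ D + (T + 1) * (η / 2 * N)) :
    1 / (T : ℝ) * A ≤ D / (T * γ) + B * η / γ := by
  have hT' : (1 : ℝ) ≤ T := by exact_mod_cast hT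
  have hη : 0 < η := by linarith
  have h1 : 1 / (T : ℝ) * A ≤ D / (T * (η / 2)) + 2 * N := by
    -- The extra noise term is absorbed by `T + 1 ≤ 2T`; the factor `2` is then covered by `η / γ ≥
    -- 2`.
    have h2 : (T + 1) * (η / 2 * N) ≤ (2 * T) * (η / 2 * N) := by
      gcongr
      linarith
    have e : D / (T * (η / 2)) + 2 * N = 1 / (T * (η / 2)) * (D + (2 * T) * (η / 2 * N)) := by
      field_simp
    have e2 : 1 / (T : ℝ) * A = 1 / (T * (η / 2)) * (η / 2 * A) := by field_simp
    rw [e, e2]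
    gcongr
    linarith
  have h3 : D / (T * (η / 2)) ≤ D / (T * γ) := by gcongr
  have h4 : 2 ≤ η / γ := by rw [le_div_iff₀ hγ]; linarith
  have h5 : 2 * N ≤ η / γ * B := mul_le_mul h4 hNB hN (by positivity)
  have h6 : η / γ * B = B * η / γ := by ring
  linarith

end Rate

end ZOProxSAGA

end

/-! ### The two claims. -/

theorem theorem4 :
    -- the nonasymptotic bound
    (∀ (d n b T : ℕ) (f : Fin n → ZOProxSAGA.E d → ℝ) (ψ : ZOProxSAGA.E d → ℝ)
      (L σ ρ μ η γ : ℝ) (x₀ xstar : ZOProxSAGA.E d)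
      (Ω : Type*) [MeasurableSpace Ω] (P : Measure Ω) [IsProbabilityMeasure P]
      (I : ℕ → Fin b → Ω → Fin n) (U : ℕ → Fin n → Ω → ZOProxSAGA.E d),
      ZOProxSAGA.Assumptions f ψ L σ →
      (∀ x, ZOProxSAGA.objective f ψ xstar ≤ ZOProxSAGA.objective f ψ x) →
      ZOProxSAGA.Sampling P I U →
      1 ≤ b → b ≤ n → 1 ≤ T → 0 < μ → 0 < ρ → ρ < 1 / 2 →
      η = ρ / L → γ = η / 2 - L * η ^ 2 →
      96 * ρ ^ 2 * (n : ℝ) ^ 2 / (b : ℝ) ^ 3 + ρ ≤ 1 →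
      (∀ t ∈ Finset.Icc 1 T, Integrable (fun ω => ‖ZOProxSAGA.gradMap η f ψ
        (ZOProxSAGA.iterate f ψ μ η x₀ I U t ω)‖ ^ 2) P) ∧
      (1 / (T : ℝ)) * ∑ t ∈ Finset.Icc 1 T, ∫ ω, ‖ZOProxSAGA.gradMap η f ψ
          (ZOProxSAGA.iterate f ψ μ η x₀ I U t ω)‖ ^ 2 ∂P
        ≤ (ZOProxSAGA.objective f ψ x₀ - ZOProxSAGA.objective f ψ xstar) / (T * γ)
          + (2 + 12 / (b : ℝ)) * (2 * d + 9) * σ ^ 2 * η / γ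
          + (1 + 6 / (b : ℝ)) * ((d : ℝ) + 6) ^ 3 * L ^ 2 * μ ^ 2 * η / γ) ∧
    -- the rate for the choice `b = [n^(2/3)]`, `ρ = 1/12`, `μ = O(1/(d√T))`
    (∃ C₂ : ℝ, ∀ L K : ℝ, 0 < L → 0 < K → ∃ C₁ : ℝ,
      ∀ (d n b T : ℕ) (f : Fin n → ZOProxSAGA.E d → ℝ) (ψ : ZOProxSAGA.E d → ℝ)
      (σ μ η : ℝ) (x₀ xstar : ZOProxSAGA.E d)
      (Ω : Type*) [MeasurableSpace Ω] (P : Measure Ω) [IsProbabilityMeasure P]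
      (I : ℕ → Fin b → Ω → Fin n) (U : ℕ → Fin n → Ω → ZOProxSAGA.E d),
      ZOProxSAGA.Assumptions f ψ L σ →
      (∀ x, ZOProxSAGA.objective f ψ xstar ≤ ZOProxSAGA.objective f ψ x) →
      ZOProxSAGA.Sampling P I U →
      1 ≤ n → 1 ≤ T →
      (b = ⌊(n : ℝ) ^ (2 / 3 : ℝ)⌋₊ ∨ b = ⌈(n : ℝ) ^ (2 / 3 : ℝ)⌉₊) →
      η = 1 / (12 * L) → 0 < μ → μ ≤ K / (d * Real.sqrt T) →
      (∀ t ∈ Finset.Icc 1 T, Integrable (fun ω => ‖ZOProxSAGA.gradMap η f ψ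
        (ZOProxSAGA.iterate f ψ μ η x₀ I U t ω)‖ ^ 2) P) ∧
      (1 / (T : ℝ)) * ∑ t ∈ Finset.Icc 1 T, ∫ ω, ‖ZOProxSAGA.gradMap η f ψ
          (ZOProxSAGA.iterate f ψ μ η x₀ I U t ω)‖ ^ 2 ∂P
        ≤ 144 * L * (ZOProxSAGA.objective f ψ x₀ - ZOProxSAGA.objective f ψ xstar) / (5 * T)
          + C₁ * (d / T) + C₂ * (d * σ ^ 2)) := by
  -- Here `13` bounds `1 + 12/b`, `11` comes from `2d + 9 ≤ 11d`, `343/2` from `(d + 6)³ ≤ (7d)³`,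
  -- and `12/5` is `η/γ`.
  refine ⟨?_, 13 * 11 * (12 / 5), fun L K hL hK => ⟨13 * (343 / 2) * K ^ 2 * L ^ 2 * (12 / 5), ?_⟩⟩
  · intro d n b T f ψ L σ ρ μ η γ x₀ xstar Ω _ P _ I U H hmin hS hb hbn hT hμ hρ hρ2 hη hγ hcond
    have hL := H.L_pos
    have hη0 : 0 < η := by rw [hη]; positivity
    have hηL : η * L = ρ := by rw [hη]; field_simp
    have hcond' : 30 * (η * L) ^ 2 * (n : ℝ) ^ 2 / (b : ℝ) ^ 3 + η * L ≤ 1 := by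
      rw [hηL]
      have : 30 * ρ ^ 2 * (n : ℝ) ^ 2 / (b : ℝ) ^ 3 ≤ 96 * ρ ^ 2 * (n : ℝ) ^ 2 / (b : ℝ) ^ 3 := by
        gcongr
        norm_num
      linarith
    obtain ⟨h1, h2⟩ := ZOProxSAGA.sum_integral_norm_gradMap_sq_le H hS x₀ hb hbn hη0 hμ hcond' hmin
    refine ⟨fun t _ => h1 t, ?_⟩
    have hγ' : γ = η * (1 / 2 - ρ) := by rw [hγ, ← hηL]; ring
    have hγ0 : 0 < γ := by rw [hγ']; exact mul_pos hη0 (by linarith)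
    have hγη : γ ≤ η / 2 := by
      have : 0 ≤ L * η ^ 2 := by positivity
      linarith
    have hM := ZOProxSAGA.gauSGEErr_nonneg (d := d) (L := L) (σ := σ) (μ := μ)
    refine (ZOProxSAGA.mean_le_of_sum_le
      (B := (2 + 12 / b) * ZOProxSAGA.gauSGEErr d L σ μ) hT hγ0 hγη
      (sub_nonneg.2 (hmin x₀)) (mul_nonneg (by positivity) hM) (by gcongr; norm_num)
      (h2 T)).trans_eq ?_
    unfold ZOProxSAGA.gauSGEErr
    ring
  · intro d n b T f ψ σ μ η x₀ xstar Ω _ P _ I U H hmin hS hn hT hb hη hμ hμK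
    obtain ⟨hb1, hbn, hnb⟩ := ZOProxSAGA.sq_le_four_mul_cube_of_eq_floor_or_ceil hn hb
    have hT' : (1 : ℝ) ≤ T := by exact_mod_cast hT
    have hb' : (1 : ℝ) ≤ b := by exact_mod_cast hb1
    have hη0 : 0 < η := by rw [hη]; positivity
    have hηL : η * L = 1 / 12 := by rw [hη]; field_simp
    have hcond' : 30 * (η * L) ^ 2 * (n : ℝ) ^ 2 / (b : ℝ) ^ 3 + η * L ≤ 1 := by
      rw [hηL]
      -- Only `n² ≤ 4b³` is available, and then `30 · 4/144 + 1/12 ≤ 1`. With `96` in place of `30`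
      -- this would fail, so the second claim is not deduced from the first.
      have : 30 * (1 / 12) ^ 2 * (n : ℝ) ^ 2 / (b : ℝ) ^ 3 ≤ 30 * (1 / 12) ^ 2 * 4 := by
        rw [div_le_iff₀ (by positivity)]
        linarith
      linarith
    obtain ⟨h1, h2⟩ := ZOProxSAGA.sum_integral_norm_gradMap_sq_le H hS x₀ hb1 hbn hη0 hμ hcond' hmin
    refine ⟨fun t _ => h1 t, ?_⟩
    -- If `d = 0`, division by zero turns the bound on `μ` into `μ ≤ 0`.
    have hd : (1 : ℝ) ≤ d := by
      have : d ≠ 0 := by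
        rintro rfl
        simp at hμK
        linarith
      exact_mod_cast Nat.one_le_iff_ne_zero.2 this
    have hM0 := ZOProxSAGA.gauSGEErr_nonneg (d := d) (L := L) (σ := σ) (μ := μ)
    have hM : ZOProxSAGA.gauSGEErr d L σ μ ≤
        11 * (d * σ ^ 2) + 343 / 2 * K ^ 2 * L ^ 2 * (d / T) := by
      have h3 : (2 * (d : ℝ) + 9) * σ ^ 2 ≤ 11 * d * σ ^ 2 := by
        gcongr
        linarith
      have h4 : ((d : ℝ) + 6) ^ 3 ≤ (7 * d) ^ 3 := by
        gcongr
        linarith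
      have h5 : μ ^ 2 ≤ (K / (d * Real.sqrt T)) ^ 2 := by gcongr
      have h6 : ((d : ℝ) + 6) ^ 3 * L ^ 2 * μ ^ 2 ≤
          (7 * d) ^ 3 * L ^ 2 * (K / (d * Real.sqrt T)) ^ 2 := by gcongr
      have h7 : (7 * (d : ℝ)) ^ 3 * L ^ 2 * (K / (d * Real.sqrt T)) ^ 2 =
          343 * K ^ 2 * L ^ 2 * (d / T) := by
        rw [div_pow, mul_pow (d : ℝ), Real.sq_sqrt (by positivity)]
        field_simp
        ring
      unfold ZOProxSAGA.gauSGEErr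
      linarith
    have h12 : 1 + 12 / (b : ℝ) ≤ 13 := by
      have : 12 / (b : ℝ) ≤ 12 := div_le_self (by norm_num) hb'
      linarith
    -- This is `η/2 - Lη²` at `η = 1/(12L)`.
    refine (ZOProxSAGA.mean_le_of_sum_le (γ := 5 / (144 * L))
      (B := 13 * (11 * (d * σ ^ 2) + 343 / 2 * K ^ 2 * L ^ 2 * (d / T))) hT (by positivity) ?_
      (sub_nonneg.2 (hmin x₀)) (mul_nonneg (by positivity) hM0) (by gcongr)
      (h2 T)).trans_eq ?_
    · rw [hη, div_div, div_le_div_iff₀ (by positivity) (by positivity)]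
      linarith
    · rw [hη]
      field_simp
      ring
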